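/- Let $\mathcal P$ be a family of probability measures on a measurable space $(\Omega,\mathcal A)$ and let $P\in\mathcal P$. A local alternative at $P$ within $\mathcal P$ with tangent $g\in L_2(P)$ is a path $s\mapsto P_{g,s}$ of probability measures such that $P_{g,s}\in\mathcal P$ for all small $s>0$ and $$\sqrt{dP_{g,s}}=\bigl(1+\tfrac s2 g\bigr)\sqrt{dP}+o(s)\quad\text{in } L_2,\ \text{as } s\downarrow 0 .$$ The tangent set $\mathcal G$ is the set of all $g\in L_2(P)$ with $\int g\,dP=0$ for which such a path exists; it is a cone with vertex at $0$. Assume that $\mathcal G$ is closed and convex. Fix a class of local alternatives that contains at least one for each $g\in\mathcal G$ (for example all of them, or a selected one for each $g$); below, $P_{g,s}$ stands for any local alternative of this class with tangent $g$. Let $T:\mathcal P\to\mathbb R$ be differentiable at $P$ along this class: there is $\kappa\in L_2(P)$ such that $T(P_{g,s})=T(P)+s\langle\kappa|g\rangle+o(s)$ as $s\downarrow0$, for all $g\in\mathcal G$. Let $\hat\kappa$ be the best approximation of $\kappa$ in $\mathcal G$, let $\bar\kappa$ be the orthogonal projection of $\kappa$ on the closed linear span of $\mathcal G$, and assume $\hat\kappa\neq0$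 and $\hat\kappa\ne\bar\kappa$. Write $P_{n,g,t}=P_{g,t/\sqrt n}$, let $Q^n$ be the law of $n$ i.i.d. observations from $Q$, and let $\Phi$ be the standard normal distribution function. Then there is $g_1\in\mathcal G$ such that every estimator sequence $\hat S=(\hat S_n)$ of the one-sided optimal form $$\sqrt n\,\bigl(\hat S_n-T(P)\bigr)_+=\Bigl(n^{-1/2}\sum_{i=1}^n\hat\kappa(x_i)\Bigr)_+ + o_{P^n}(1)$$ satisfies, for all $c\ge0$, $$\lim_{t\to\infty}\lim_{n\to\infty}P^n_{n,g_1,t}\bigl\{T(P_{n,g_1,t})\ge \hat S_n-\tfrac{c}{\sqrt n}\bigr\}=0<\Phi\bigl(\tfrac{c}{\|\hat\kappa\|}\bigr),$$ where the inner limit exists for every $t>0$. Moreover $$\lim_{t\to\infty}\lim_{n\to\infty}P^n_{n,g_1,t}\bigl\{\hat S_n>T(P_{n,g_1,t})\bigr\}=1 ,$$ and in particular $\hat S$ violates the condition that $\limsup_{n\to\infty}P^n_{n,g_1,t}\{\hat S_n>T(P_{n,g_1,t})\}\le\frac12$ for all $t>0$. -/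

import Mathlib

open MeasureTheory ProbabilityTheory Filter Topology Asymptotics

noncomputable section

namespace OneSided

variable {Ω : Type*} [MeasurableSpace Ω]

/-- The remainder `√dQ - (1 + (s/2) g) √dP`, as a function on the sample space: the densities
of `Q` and `P` are taken with respect to the dominating measure `P + Q` (the `L²`-norm of the
remainder does not depend on the choice of the dominating measure). -/
def rootRemainder (P Q : ProbabilityMeasure Ω) (g : Lp ℝ 2 (P : Measure Ω)) (s : ℝ) (x : Ω) : ℝ :=
  let μ : Measure Ω := (P : Measure Ω) + (Q : Measure Ω)
  √(((Q : Measure Ω).rnDeriv μ x).toReal)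
    - (1 + s / 2 * g x) * √(((P : Measure Ω).rnDeriv μ x).toReal)

/-- `s ↦ Q s` is a local alternative `P_{g,s}` at `P` within the family `𝓜`, with tangent `g`:
`Q s ∈ 𝓜` for all small `s > 0`, and `√dQ_s = (1 + (s/2) g) √dP + o(s)` in the sense of `L²`
as `s ↓ 0`. -/
def IsLocalAlternative (𝓜 : Set (ProbabilityMeasure Ω)) (P : ProbabilityMeasure Ω)
    (g : Lp ℝ 2 (P : Measure Ω)) (Q : ℝ → ProbabilityMeasure Ω) : Prop :=
  (∀ᶠ s in 𝓝[>] (0 : ℝ), Q s ∈ 𝓜) ∧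
  Tendsto (fun s : ℝ =>
      eLpNorm (rootRemainder P (Q s) g s) 2 ((P : Measure Ω) + (Q s : Measure Ω))
        / ENNReal.ofReal s)
    (𝓝[>] 0) (𝓝 0)

/-- The tangent set of `𝓜` at `P`: all `g ∈ L²(P)` with `g ⊥ 1` that are the tangent of some
local alternative at `P` within `𝓜`. -/
def tangentSet (𝓜 : Set (ProbabilityMeasure Ω)) (P : ProbabilityMeasure Ω) :
    Set (Lp ℝ 2 (P : Measure Ω)) :=
  {g | ∫ x, g x ∂(P : Measure Ω) = 0 ∧ ∃ Q, IsLocalAlternative 𝓜 P g Q}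

/-- `T(Q_s) = T(P) + s ⟨κ, g⟩ + o(s)` as `s ↓ 0`. -/
def DifferentiableAlong (T : ProbabilityMeasure Ω → ℝ) (P : ProbabilityMeasure Ω)
    (κ g : Lp ℝ 2 (P : Measure Ω)) (Q : ℝ → ProbabilityMeasure Ω) : Prop :=
  (fun s : ℝ => T (Q s) - T P - s * inner ℝ κ g) =o[𝓝[>] 0] (fun s : ℝ => s)

/-- `a` is a best approximation of `κ` in `G`, i.e. its (in general nonlinear) projection on `G`;
it exists and is unique if `G` is nonempty, closed and convex. -/
def IsProjectionOn {E : Type*} [NormedAddCommGroup E] (G : Set E) (κ a : E) : Prop :=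
  a ∈ G ∧ ∀ g ∈ G, ‖κ - a‖ ≤ ‖κ - g‖

/-- The orthogonal projection of `κ` on the closed linear span of `G`. -/
def spanProjection {E : Type*} [NormedAddCommGroup E] [InnerProductSpace ℝ E] [CompleteSpace E]
    (G : Set E) (κ : E) : E :=
  (Submodule.span ℝ G).topologicalClosure.starProjection κ

/-- The joint law `Qⁿ` of `n` i.i.d. observations with law `Q`. -/
def iidLaw (Q : ProbabilityMeasure Ω) (n : ℕ) : Measure (Fin n → Ω) :=
  Measure.pi fun _ => (Q : Measure Ω)

/-- The one-sided optimal form of an estimator sequence: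
`√n (S_n - T(P))₊ = (n^{-1/2} ∑ κ̂(x_i))₊ + o(1)` in `Pⁿ`-probability. -/
def HasOneSidedOptimalForm (T : ProbabilityMeasure Ω → ℝ) (P : ProbabilityMeasure Ω)
    (κhat : Lp ℝ 2 (P : Measure Ω)) (S : (n : ℕ) → (Fin n → Ω) → ℝ) : Prop :=
  ∀ ε : ℝ, 0 < ε → Tendsto (fun n : ℕ => (iidLaw P n).real
      {x | ε ≤ |√(n : ℝ) * max (S n x - T P) 0 - max ((√(n : ℝ))⁻¹ * ∑ i, κhat (x i)) 0|})
    atTop (𝓝 0)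

/-- `S` asymptotically has median at most `T` along the local alternative `Q`: for all `t > 0`,
`limsup_n P^n_{n,t} {S_n > T(P_{n,t})} ≤ 1/2`, where `P_{n,t} = Q (t/√n)`. -/
def HasAsymptoticMedianLE (T : ProbabilityMeasure Ω → ℝ) (Q : ℝ → ProbabilityMeasure Ω)
    (S : (n : ℕ) → (Fin n → Ω) → ℝ) : Prop :=
  ∀ t : ℝ, 0 < t → limsup (fun n : ℕ => (iidLaw (Q (t / √(n : ℝ))) n).real
      {x | S n x > T (Q (t / √(n : ℝ)))}) atTop ≤ 1 / 2

/-- The iterated limit `lim_{t→∞} lim_{n→∞} a t n` exists and equals `l`; the inner limit is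
required to exist for every `t > 0`. -/
def HasIteratedLimit (a : ℝ → ℕ → ℝ) (l : ℝ) : Prop :=
  ∃ L : ℝ → ℝ, (∀ t : ℝ, 0 < t → Tendsto (a t) atTop (𝓝 (L t))) ∧ Tendsto L atTop (𝓝 l)

/-- The standard normal distribution function. -/
def stdNormalCDF (x : ℝ) : ℝ := cdf (gaussianReal 0 1) x

end OneSided

end

/-! Geometry: since the tangent set is a convex cone, `κ - κhat` is orthogonal to `κhat` and has
nonpositive inner product with every tangent. If all these products vanished, `κhat` would be the
projection on the closed span; so some tangent gives a negative one. Mixing a little of it into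
`κhat` yields `g₁` with 0 < ⟨κ, g₁⟩ < ⟨κhat, g₁⟩ (`IsProjectionOn.exists_inner_lt`).

Statistics: along the alternative with tangent `g₁`, the functional moves on the scale 1/√n by t⟨κ,
g₁⟩, while the normalized sum of `κhat` is asymptotically normal with the larger mean t⟨κhat, g₁⟩.
The estimator thus overshoots by an amount proportional to t: the coverage tends to the N(0,
‖κhat‖²) distribution function at c - t(⟨κhat, g₁⟩ - ⟨κ, g₁⟩), which vanishes as t → ∞. Knowing only
the positive part of the estimator suffices, because the threshold c + t⟨κ, g₁⟩ is positive
(`HasOneSidedOptimalForm.tendsto_coverage`).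

The asymptotics avoid likelihood expansions. The alternative is replaced by (1 + s h) dP with h a
truncated, centered version of g. Its Hellinger distance from the alternative is o(s), so at s =
t/√n the product laws merge in total variation. For the explicit densities, characteristic functions
give the shifted normal limit, and a bounded second moment of the product density gives contiguity.
-/

namespace OneSided

/-! ### Product measures with densities: Hellinger and second-moment bounds. -/

section ProductDensities

variable {Ω : Type*} [MeasurableSpace Ω] {μ : Measure Ω}

theorem integral_abs_mul_le_sqrt_mul_sqrt {f g : Ω → ℝ} (hf : MemLp f 2 μ) (hg : MemLp g 2 μ) :
    ∫ x, |f x * g x| ∂μ ≤ √(∫ x, f x ^ 2 ∂μ) * √(∫ x, g x ^ 2 ∂μ) := by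
  have h := integral_mul_norm_le_Lp_mul_Lq (μ := μ) (f := f) (g := g) Real.HolderConjugate.two_two
    (by simpa using hf) (by simpa using hg)
  simpa [abs_mul, Real.sqrt_eq_rpow] using h

theorem integral_add_const_mul_sq {f g : Ω → ℝ} (hf : MemLp f 2 μ) (hg : MemLp g 2 μ) (c : ℝ) :
    ∫ x, (f x + c * g x) ^ 2 ∂μ =
      ∫ x, f x ^ 2 ∂μ + 2 * c * ∫ x, f x * g x ∂μ + c ^ 2 * ∫ x, g x ^ 2 ∂μ := by
  have hfg : Integrable (fun x => f x * g x) μ := hf.integrable_mul hg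
  have h1 : Integrable (fun x => f x ^ 2 + 2 * c * (f x * g x)) μ :=
    hf.integrable_sq.add (hfg.const_mul _)
  have : ∀ x, (f x + c * g x) ^ 2 = f x ^ 2 + 2 * c * (f x * g x) + c ^ 2 * g x ^ 2 :=
    fun x => by ring
  simp_rw [this]
  rw [integral_add h1 (hg.integrable_sq.const_mul _),
    integral_add hf.integrable_sq (hfg.const_mul _), integral_const_mul, integral_const_mul]

theorem pi_withDensity_ofReal [IsFiniteMeasure μ] {f : Ω → ℝ}
    (hf0 : ∀ x, 0 ≤ f x) (hfi : Integrable f μ) (n : ℕ) :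
    Measure.pi (fun _ : Fin n => μ.withDensity fun x => ENNReal.ofReal (f x)) =
      (Measure.pi fun _ : Fin n => μ).withDensity fun x => ENNReal.ofReal (∏ i, f (x i)) := by
  have : IsFiniteMeasure (μ.withDensity fun x => ENNReal.ofReal (f x)) :=
    isFiniteMeasure_withDensity_ofReal hfi.2
  refine Measure.pi_eq fun s hs => ?_
  rw [withDensity_apply _ (MeasurableSet.univ_pi hs), Measure.restrict_pi_pi,
    ← ofReal_integral_eq_lintegral_ofReal, integral_fintype_prod_eq_prod (fun _ => f),
    ENNReal.ofReal_prod_of_nonneg (fun i _ => integral_nonneg hf0)]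
  · refine Finset.prod_congr rfl fun i _ => ?_
    rw [withDensity_apply _ (hs i), ofReal_integral_eq_lintegral_ofReal hfi.restrict
      (ae_of_all _ hf0)]
  · exact Integrable.fintype_prod (f := fun _ => f) fun i => hfi.restrict
  · exact ae_of_all _ fun x => Finset.prod_nonneg fun i _ => hf0 _

theorem real_withDensity_ofReal {f : Ω → ℝ} (hf0 : ∀ x, 0 ≤ f x) (hfi : Integrable f μ)
    {A : Set Ω} (hA : MeasurableSet A) :
    (μ.withDensity fun x => ENNReal.ofReal (f x)).real A = ∫ x in A, f x ∂μ := by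
  rw [measureReal_def, withDensity_apply _ hA,
    integral_eq_lintegral_of_nonneg_ae (ae_of_all _ hf0) hfi.1.restrict]

theorem memLp_two_prod [IsFiniteMeasure μ] {u : Ω → ℝ} (hum : Measurable u) (hu : MemLp u 2 μ)
    (n : ℕ) :
    MemLp (fun x : Fin n → Ω => ∏ i, u (x i)) 2 (Measure.pi fun _ => μ) := by
  have hm : Measurable (fun x : Fin n → Ω => ∏ i, u (x i)) :=
    Finset.measurable_prod _ fun i _ => hum.comp (measurable_pi_apply i)
  rw [memLp_two_iff_integrable_sq hm.aestronglyMeasurable]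
  simp_rw [← Finset.prod_pow]
  exact Integrable.fintype_prod (f := fun _ x => u x ^ 2) fun _ => hu.integrable_sq

/-- The total variation distance of `n`-fold products is controlled by the Hellinger distance of
the factors. -/
theorem abs_pi_real_sub_le [IsFiniteMeasure μ] {u v : Ω → ℝ} (hum : Measurable u)
    (hvm : Measurable v) (hu0 : ∀ x, 0 ≤ u x) (hv0 : ∀ x, 0 ≤ v x)
    (hu : MemLp u 2 μ) (hv : MemLp v 2 μ) (hu1 : ∫ x, u x ^ 2 ∂μ = 1) (hv1 : ∫ x, v x ^ 2 ∂μ = 1)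
    (n : ℕ) {A : Set (Fin n → Ω)} (hA : MeasurableSet A) :
    |(Measure.pi fun _ : Fin n => μ.withDensity fun x => ENNReal.ofReal (u x ^ 2)).real A -
      (Measure.pi fun _ : Fin n => μ.withDensity fun x => ENNReal.ofReal (v x ^ 2)).real A|
      ≤ 2 * √(n * ∫ x, (u x - v x) ^ 2 ∂μ) := by
  set m : Measure (Fin n → Ω) := Measure.pi fun _ => μ
  set U : (Fin n → Ω) → ℝ := fun x => ∏ i, u (x i) with hUdef
  set V : (Fin n → Ω) → ℝ := fun x => ∏ i, v (x i) with hVdef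
  have hU : MemLp U 2 m := memLp_two_prod hum hu n
  have hV : MemLp V 2 m := memLp_two_prod hvm hv n
  have hUV : Integrable (fun x => U x * V x) m := hU.integrable_mul hV
  have huv : Integrable (fun x => u x * v x) μ := hu.integrable_mul hv
  have hUsq : ∀ x, ∏ i, u (x i) ^ 2 = U x ^ 2 := fun x => Finset.prod_pow _ _ _
  have hVsq : ∀ x, ∏ i, v (x i) ^ 2 = V x ^ 2 := fun x => Finset.prod_pow _ _ _
  have iU : ∫ x, U x ^ 2 ∂m = 1 := by
    simp_rw [← hUsq]
    rw [integral_fintype_prod_eq_pow (fun x => u x ^ 2), hu1, one_pow]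
  have iV : ∫ x, V x ^ 2 ∂m = 1 := by
    simp_rw [← hVsq]
    rw [integral_fintype_prod_eq_pow (fun x => v x ^ 2), hv1, one_pow]
  have iUV : ∫ x, U x * V x ∂m = (∫ x, u x * v x ∂μ) ^ n := by
    simp_rw [hUdef, hVdef, ← Finset.prod_mul_distrib]
    rw [integral_fintype_prod_eq_pow (fun x => u x * v x), Fintype.card_fin]
  set ρ := ∫ x, u x * v x ∂μ
  have hρ0 : 0 ≤ ρ := integral_nonneg fun x => mul_nonneg (hu0 x) (hv0 x)
  have h2 : ∫ x, (u x - v x) ^ 2 ∂μ = 2 - 2 * ρ := by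
    have h := integral_add_const_mul_sq hu hv (-1)
    simp only [neg_one_mul, ← sub_eq_add_neg, hu1, hv1] at h
    linarith
  have hm : ∫ x, (U x - V x) ^ 2 ∂m = 2 - 2 * ρ ^ n := by
    have h := integral_add_const_mul_sq hU hV (-1)
    simp only [neg_one_mul, ← sub_eq_add_neg, iU, iV, iUV] at h
    linarith
  have hp : ∫ x, (U x + V x) ^ 2 ∂m = 2 + 2 * ρ ^ n := by
    have h := integral_add_const_mul_sq hU hV 1
    simp only [one_mul, iU, iV, iUV] at h
    linarith
  have hρn : ρ ^ n ≤ 1 := by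
    have : 0 ≤ ∫ x, (U x - V x) ^ 2 ∂m := integral_nonneg fun x => sq_nonneg _
    linarith
  -- Bernoulli's inequality: the squared Hellinger distance 2 - 2ρⁿ of the products is at most n
  -- times that of the factors.
  have hB : 1 + (n : ℝ) * (ρ - 1) ≤ ρ ^ n := by
    simpa using one_add_mul_le_pow (a := ρ - 1) (by linarith) n
  have key : ∀ {w : Ω → ℝ}, Measurable w → MemLp w 2 μ →
      (Measure.pi fun _ : Fin n => μ.withDensity fun x => ENNReal.ofReal (w x ^ 2)).real A =
        ∫ x in A, (∏ i, w (x i)) ^ 2 ∂m := by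
    intro w hwm hw
    rw [pi_withDensity_ofReal (fun x => sq_nonneg _) hw.integrable_sq]
    simp_rw [Finset.prod_pow]
    exact real_withDensity_ofReal (fun x => sq_nonneg _) (memLp_two_prod hwm hw n).integrable_sq hA
  rw [key hum hu, key hvm hv]
  change |∫ x in A, U x ^ 2 ∂m - ∫ x in A, V x ^ 2 ∂m| ≤ _
  rw [← integral_sub hU.integrable_sq.restrict hV.integrable_sq.restrict]
  have hint : Integrable (fun x => U x ^ 2 - V x ^ 2) m := hU.integrable_sq.sub hV.integrable_sq
  -- Factor U² - V² = (U - V)(U + V) and apply Cauchy-Schwarz; the second factor has norm at most 2.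
  calc |∫ x in A, (U x ^ 2 - V x ^ 2) ∂m|
      ≤ ∫ x in A, |U x ^ 2 - V x ^ 2| ∂m := abs_integral_le_integral_abs
    _ ≤ ∫ x, |U x ^ 2 - V x ^ 2| ∂m :=
        setIntegral_le_integral hint.abs (ae_of_all _ fun x => abs_nonneg _)
    _ = ∫ x, |(U x - V x) * (U x + V x)| ∂m := by
        congr 1; ext x; congr 1; ring
    _ ≤ √(∫ x, (U x - V x) ^ 2 ∂m) * √(∫ x, (U x + V x) ^ 2 ∂m) :=
        integral_abs_mul_le_sqrt_mul_sqrt (hU.sub hV) (hU.add hV)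
    _ ≤ √(n * ∫ x, (u x - v x) ^ 2 ∂μ) * 2 := by
        refine mul_le_mul (Real.sqrt_le_sqrt ?_) ?_ (Real.sqrt_nonneg _) (Real.sqrt_nonneg _)
        · rw [hm, h2]; linarith
        · rw [hp]
          exact Real.sqrt_le_iff.2 ⟨by norm_num, by linarith⟩
    _ = _ := mul_comm _ _

/-- Cauchy-Schwarz for the product density against the indicator of A. It yields contiguity once the
n-th power of the second moment stays bounded. -/
theorem pi_withDensity_real_le [IsProbabilityMeasure μ] {f : Ω → ℝ} (hfm : Measurable f)
    (hf0 : ∀ x, 0 ≤ f x) (hf : MemLp f 2 μ) (n : ℕ) {A : Set (Fin n → Ω)} (hA : MeasurableSet A) :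
    (Measure.pi fun _ : Fin n => μ.withDensity fun x => ENNReal.ofReal (f x)).real A ≤
      √((∫ x, f x ^ 2 ∂μ) ^ n) * √((Measure.pi fun _ : Fin n => μ).real A) := by
  have hF := memLp_two_prod hfm hf n
  have hFi := hF.integrable (by norm_num)
  have hF0 : ∀ x : Fin n → Ω, 0 ≤ ∏ i, f (x i) := fun x => Finset.prod_nonneg fun i _ => hf0 _
  rw [pi_withDensity_ofReal hf0 (hf.integrable (by norm_num)),
    real_withDensity_ofReal hF0 hFi hA]
  have h1 : MemLp (A.indicator fun _ => (1 : ℝ)) 2 (Measure.pi fun _ : Fin n => μ) :=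
    (memLp_const 1).indicator hA
  have h := integral_abs_mul_le_sqrt_mul_sqrt hF h1
  have e1 : ∫ x : Fin n → Ω, (∏ i, f (x i)) ^ 2 ∂(Measure.pi fun _ => μ)
      = (∫ x, f x ^ 2 ∂μ) ^ n := by
    simp_rw [← Finset.prod_pow]
    rw [integral_fintype_prod_eq_pow (fun x => f x ^ 2), Fintype.card_fin]
  have e2 : ∫ x, (A.indicator (fun _ => (1 : ℝ)) x) ^ 2 ∂(Measure.pi fun _ : Fin n => μ)
      = (Measure.pi fun _ : Fin n => μ).real A := by
    rw [← integral_indicator_one hA]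
    congr 1; ext x
    by_cases hx : x ∈ A <;> simp [hx]
  have e3 : ∫ x in A, ∏ i, f (x i) ∂(Measure.pi fun _ : Fin n => μ) =
      ∫ x, |(∏ i, f (x i)) * A.indicator (fun _ => (1 : ℝ)) x| ∂(Measure.pi fun _ : Fin n => μ) := by
    rw [← integral_indicator hA]
    congr 1; ext x
    by_cases hx : x ∈ A <;> simp [hx, abs_of_nonneg, hf0, Finset.prod_nonneg]
  rw [e3]
  rwa [e1, e2] at h

end ProductDensities

/-! ### Central limit theorem along local perturbations, by characteristic functions. -/

section CentralLimit

variable {Ω : Type*} [MeasurableSpace Ω] {P : Measure Ω}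

theorem tendsto_inv_sqrt_natCast : Tendsto (fun n : ℕ => (√(n : ℝ))⁻¹) atTop (𝓝 0) :=
  tendsto_inv_atTop_zero.comp (Real.tendsto_sqrt_atTop.comp tendsto_natCast_atTop_atTop)

theorem tendsto_sqrt_mul_exp_sub_one (a : ℝ) :
    Tendsto (fun n : ℕ => ((√(n : ℝ) : ℝ) : ℂ) *
      (Complex.exp (Complex.I * (((√(n : ℝ))⁻¹ * a : ℝ) : ℂ)) - 1)) atTop
      (𝓝 (Complex.I * a)) := by
  have hd : HasDerivAt (fun r : ℝ => Complex.exp (Complex.I * ((r * a : ℝ) : ℂ)))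
      (Complex.I * a) 0 := by
    have h1 : HasDerivAt (fun r : ℝ => Complex.I * ((r * a : ℝ) : ℂ)) (Complex.I * a) 0 := by
      have := ((hasDerivAt_id (0 : ℝ)).mul_const a).ofReal_comp.const_mul Complex.I
      simpa using this
    simpa using h1.cexp
  have ht : Tendsto (fun n : ℕ => (√(n : ℝ))⁻¹) atTop (𝓝[>] 0) :=
    tendsto_inv_atTop_nhdsGT_zero.comp (Real.tendsto_sqrt_atTop.comp tendsto_natCast_atTop_atTop)
  refine (hd.tendsto_slope_zero_right.comp ht).congr fun n => ?_
  simp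

/-- The rescaled factor is bounded by |uκ|, because |e^{iy} - 1| ≤ |y|. Hence replacing `h n` by `g`
costs only an L² error, and dominated convergence treats the integral with `g`. -/
theorem tendsto_sqrt_mul_integral_exp_sub_one_mul {κ g : Ω → ℝ} (hκm : Measurable κ)
    (hκ : MemLp κ 2 P) (hg : MemLp g 2 P) {h : ℕ → Ω → ℝ} (hh : ∀ n, MemLp (h n) 2 P)
    (hconv : Tendsto (fun n => ∫ x, (h n x - g x) ^ 2 ∂P) atTop (𝓝 0)) (u : ℝ) :
    Tendsto (fun n : ℕ => ((√(n : ℝ) : ℝ) : ℂ) *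
      ∫ x, (Complex.exp (Complex.I * (((√(n : ℝ))⁻¹ * (u * κ x) : ℝ) : ℂ)) - 1) * (h n x : ℂ) ∂P)
      atTop (𝓝 (Complex.I * u * ((∫ x, κ x * g x ∂P : ℝ) : ℂ))) := by
  set φ : ℕ → Ω → ℂ := fun n x => ((√(n : ℝ) : ℝ) : ℂ) *
    (Complex.exp (Complex.I * (((√(n : ℝ))⁻¹ * (u * κ x) : ℝ) : ℂ)) - 1) with hφ
  have hφm : ∀ n, Measurable (φ n) := fun n => by fun_prop
  have hφb : ∀ n x, ‖φ n x‖ ≤ |u * κ x| := by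
    intro n x
    rw [hφ, norm_mul, Complex.norm_real, Real.norm_of_nonneg (Real.sqrt_nonneg _)]
    refine (mul_le_mul_of_nonneg_left Real.norm_exp_I_mul_ofReal_sub_one_le
      (Real.sqrt_nonneg _)).trans ?_
    rw [norm_mul, norm_inv, Real.norm_of_nonneg (Real.sqrt_nonneg _), ← mul_assoc, Real.norm_eq_abs]
    exact mul_le_of_le_one_left (abs_nonneg _) mul_inv_le_one
  have huκ : MemLp (fun x => u * κ x) 2 P := hκ.const_mul u
  have hint : ∀ n {f : Ω → ℝ}, MemLp f 2 P → Integrable (fun x => φ n x * (f x : ℂ)) P := by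
    intro n f hf
    refine (huκ.integrable_mul hf).mono
      ((hφm n).aestronglyMeasurable.mul (Complex.continuous_ofReal.comp_aestronglyMeasurable hf.1)) (ae_of_all _ fun x => ?_)
    change ‖φ n x * (f x : ℂ)‖ ≤ ‖u * κ x * f x‖
    rw [norm_mul (φ n x), norm_mul (u * κ x), Complex.norm_real]
    exact mul_le_mul_of_nonneg_right (hφb n x) (norm_nonneg _)
  have hd : ∀ n, MemLp (fun x => h n x - g x) 2 P := fun n => (hh n).sub hg
  have h1 : Tendsto (fun n => ∫ x, φ n x * ((h n x - g x : ℝ) : ℂ) ∂P) atTop (𝓝 0) := by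
    refine squeeze_zero_norm (a := fun n => √(∫ x, (u * κ x) ^ 2 ∂P) *
      √(∫ x, (h n x - g x) ^ 2 ∂P)) (fun n => ?_) ?_
    · refine (norm_integral_le_integral_norm _).trans (le_trans ?_
        (integral_abs_mul_le_sqrt_mul_sqrt huκ (hd n)))
      refine integral_mono (hint n (hd n)).norm
        (huκ.integrable_mul (hd n)).abs fun x => ?_
      change ‖φ n x * ((h n x - g x : ℝ) : ℂ)‖ ≤ |u * κ x * (h n x - g x)|
      rw [norm_mul, Complex.norm_real, abs_mul]
      exact mul_le_mul_of_nonneg_right (hφb n x) (norm_nonneg _)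
    · simpa using (hconv.sqrt).const_mul (√(∫ x, (u * κ x) ^ 2 ∂P))
  have h2 : Tendsto (fun n => ∫ x, φ n x * (g x : ℂ) ∂P) atTop
      (𝓝 (∫ x, Complex.I * ((u * κ x : ℝ) : ℂ) * (g x : ℂ) ∂P)) := by
    refine tendsto_integral_of_dominated_convergence (fun x => |u * κ x * g x|)
      (fun n => (hint n hg).1) (huκ.integrable_mul hg).abs (fun n => ae_of_all _ fun x => ?_)
      (ae_of_all _ fun x => (tendsto_sqrt_mul_exp_sub_one (u * κ x)).mul_const _)
    rw [norm_mul, Complex.norm_real, abs_mul]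
    exact mul_le_mul_of_nonneg_right (hφb n x) (norm_nonneg _)
  have e : ∫ x, Complex.I * ((u * κ x : ℝ) : ℂ) * (g x : ℂ) ∂P =
      Complex.I * u * ((∫ x, κ x * g x ∂P : ℝ) : ℂ) := by
    rw [← integral_complex_ofReal, ← integral_const_mul]
    congr 1; ext x; push_cast; ring
  rw [← e]
  have h3 := h1.add h2
  rw [zero_add] at h3
  refine h3.congr fun n => ?_
  rw [← integral_add (hint n (hd n)) (hint n hg), ← integral_const_mul]
  congr 1; ext x
  simp only [hφ]; push_cast; ring

variable [IsProbabilityMeasure P]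

/-- Second-order Taylor expansion of the characteristic function at 0, evaluated at u/√n, where the
remainder is o(1/n). -/
theorem tendsto_natCast_mul_charFun_sub_one {κ : Ω → ℝ} (hκm : Measurable κ) (hκ : MemLp κ 2 P)
    (hκ0 : ∫ x, κ x ∂P = 0) (u : ℝ) :
    Tendsto (fun n : ℕ => (n : ℂ) * (charFun (P.map κ) ((√(n : ℝ))⁻¹ * u) - 1)) atTop
      (𝓝 (-((∫ x, κ x ^ 2 ∂P : ℝ) : ℂ) * u ^ 2 / 2)) := by
  set v : ℝ := ∫ x, κ x ^ 2 ∂P with hv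
  have : IsProbabilityMeasure (P.map κ) := Measure.isProbabilityMeasure_map hκm.aemeasurable
  have hid : MemLp id 2 (P.map κ) := by
    rw [memLp_map_measure_iff aestronglyMeasurable_id hκm.aemeasurable]
    simpa using hκ
  have h := taylor_isLittleO_univ (x₀ := 0) (n := 2) (contDiff_charFun (by exact_mod_cast hid))
  simp_rw [taylorWithinEval_charFun_two_zero hκm.aemeasurable hid] at h
  have ht : Tendsto (fun n : ℕ => (√(n : ℝ))⁻¹ * u) atTop (𝓝 0) := by
    simpa using tendsto_inv_sqrt_natCast.mul_const u
  have h2 := (isBigO_refl (fun n : ℕ => (n : ℝ)) atTop).norm_norm.mul_isLittleO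
    (h.comp_tendsto ht).norm_norm
  have h3 : Tendsto (fun n : ℕ => (n : ℂ) * (charFun (P.map κ) ((√(n : ℝ))⁻¹ * u)
      - (1 - (v : ℂ) * (((√(n : ℝ))⁻¹ * u : ℝ) : ℂ) ^ 2 / 2))) atTop (𝓝 0) := by
    rw [tendsto_zero_iff_norm_tendsto_zero, ← isLittleO_one_iff ℝ]
    refine (h2.trans_isBigO ?_).congr_left fun n => ?_
    · refine IsBigO.of_bound (‖u ^ 2‖) ?_
      filter_upwards [eventually_gt_atTop 0] with n hn
      have hn' : (0 : ℝ) < n := by exact_mod_cast hn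
      have e : (n : ℝ) * ((√(n : ℝ))⁻¹ * u) ^ 2 = u ^ 2 := by
        rw [mul_pow, inv_pow, Real.sq_sqrt hn'.le]; field_simp
      simp only [Function.comp_apply, sub_zero]
      rw [← norm_mul, e]; simp
    · simp [hv, hκ0]
  have h4 : Tendsto (fun n : ℕ => (n : ℂ) * (charFun (P.map κ) ((√(n : ℝ))⁻¹ * u)
      - (1 - (v : ℂ) * (((√(n : ℝ))⁻¹ * u : ℝ) : ℂ) ^ 2 / 2)) + -(v : ℂ) * u ^ 2 / 2) atTop
      (𝓝 (-(v : ℂ) * u ^ 2 / 2)) := by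
    have h := h3.add_const (-(v : ℂ) * u ^ 2 / 2)
    rwa [zero_add] at h
  refine h4.congr' ?_
  filter_upwards [eventually_gt_atTop 0] with n hn
  have hn' : (0 : ℝ) < n := by exact_mod_cast hn
  have e : (n : ℝ) * ((√(n : ℝ))⁻¹ * u) ^ 2 = u ^ 2 := by
    rw [mul_pow, inv_pow, Real.sq_sqrt hn'.le]; field_simp
  have e' : (n : ℂ) * (((√(n : ℝ))⁻¹ * u : ℝ) : ℂ) ^ 2 = (u : ℂ) ^ 2 := by
    exact_mod_cast congrArg (Complex.ofReal) e
  linear_combination ((v : ℂ) / 2) * e'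

theorem charFun_pi_map_inv_sqrt_mul_sum (Q : Measure Ω) [IsProbabilityMeasure Q] {κ : Ω → ℝ}
    (hκm : Measurable κ) (n : ℕ) (u : ℝ) :
    charFun ((Measure.pi fun _ : Fin n => Q).map fun x => (√(n : ℝ))⁻¹ * ∑ i, κ (x i)) u =
      (∫ x, Complex.exp (Complex.I * (((√(n : ℝ))⁻¹ * (u * κ x) : ℝ) : ℂ)) ∂Q) ^ n := by
  have hm : Measurable fun x : Fin n → Ω => (√(n : ℝ))⁻¹ * ∑ i, κ (x i) := by fun_prop
  rw [charFun_apply_real, integral_map hm.aemeasurable (by fun_prop)]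
  have : ∀ x : Fin n → Ω, Complex.exp (u * (((√(n : ℝ))⁻¹ * ∑ i, κ (x i) : ℝ) : ℂ) * Complex.I) =
      ∏ i, Complex.exp (Complex.I * (((√(n : ℝ))⁻¹ * (u * κ (x i)) : ℝ) : ℂ)) := by
    intro x
    rw [← Complex.exp_sum, ← Finset.mul_sum]
    congr 1
    push_cast
    rw [← Finset.mul_sum, ← Finset.mul_sum]
    ring
  simp_rw [this]
  rw [integral_fintype_prod_eq_pow (fun y => Complex.exp (Complex.I *
    (((√(n : ℝ))⁻¹ * (u * κ y) : ℝ) : ℂ))), Fintype.card_fin]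

theorem isProbabilityMeasure_withDensity_ofReal {μ : Measure Ω} {f : Ω → ℝ} (hf0 : ∀ x, 0 ≤ f x)
    (hfi : Integrable f μ) (h1 : ∫ x, f x ∂μ = 1) :
    IsProbabilityMeasure (μ.withDensity fun x => ENNReal.ofReal (f x)) := by
  constructor
  rw [withDensity_apply _ MeasurableSet.univ, Measure.restrict_univ,
    ← ofReal_integral_eq_lintegral_ofReal hfi (ae_of_all _ hf0), h1, ENNReal.ofReal_one]

/-- Because h is centered, 1 may be subtracted from the exponential in the perturbation term. This
makes that term of order s·r, the same 1/n as the variance term. -/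
theorem integral_exp_withDensity {κ h : Ω → ℝ} (hκm : Measurable κ) (hm : Measurable h)
    (hh : Integrable h P) (h0 : ∫ x, h x ∂P = 0) (s r u : ℝ) (hpos : ∀ x, 0 ≤ 1 + s * h x) :
    ∫ x, Complex.exp (Complex.I * ((r * (u * κ x) : ℝ) : ℂ))
        ∂(P.withDensity fun x => ENNReal.ofReal (1 + s * h x)) =
      charFun (P.map κ) (r * u) +
        s * ∫ x, (Complex.exp (Complex.I * ((r * (u * κ x) : ℝ) : ℂ)) - 1) * (h x : ℂ) ∂P := by
  set E : Ω → ℂ := fun x => Complex.exp (Complex.I * ((r * (u * κ x) : ℝ) : ℂ)) with hE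
  have hEm : Measurable E := by fun_prop
  have hE1 : ∀ x, ‖E x‖ = 1 := fun x => by
    rw [hE]; simp only; rw [mul_comm]; exact Complex.norm_exp_ofReal_mul_I _
  have hEi : Integrable E P := (integrable_const (1 : ℝ)).mono hEm.aestronglyMeasurable
    (ae_of_all _ fun x => by simp [hE1])
  have hhC : Integrable (fun x => (h x : ℂ)) P := hh.ofReal
  have hEh : Integrable (fun x => (E x - 1) * (h x : ℂ)) P := by
    refine hhC.bdd_mul (c := 2) (hEm.sub_const 1).aestronglyMeasurable
      (ae_of_all _ fun x => ?_)
    exact (norm_sub_le _ _).trans (by rw [hE1]; norm_num)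
  have c1 : charFun (P.map κ) (r * u) = ∫ x, E x ∂P := by
    rw [charFun_apply_real, integral_map hκm.aemeasurable (by fun_prop)]
    congr 1; ext x; simp only [hE]; congr 1; push_cast; ring
  have hz : ∫ x, (h x : ℂ) ∂P = 0 := by
    rw [integral_complex_ofReal, h0]; simp
  have hs : ∀ x, (ENNReal.ofReal (1 + s * h x)).toReal • E x =
      E x + s * ((E x - 1) * (h x : ℂ)) + s * (h x : ℂ) := by
    intro x
    rw [ENNReal.toReal_ofReal (hpos x), Complex.real_smul]; push_cast; ring
  have i1 : Integrable (fun x => (s : ℂ) * ((E x - 1) * (h x : ℂ))) P := hEh.const_mul _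
  have i2 : Integrable (fun x => E x + s * ((E x - 1) * (h x : ℂ))) P := hEi.add i1
  rw [c1, integral_withDensity_eq_integral_toReal_smul
    (by fun_prop) (ae_of_all _ fun _ => ENNReal.ofReal_lt_top)]
  refine (integral_congr_ae (ae_of_all _ hs)).trans ?_
  rw [integral_add i2 (hhC.const_mul _), integral_add hEi i1,
    integral_const_mul, integral_const_mul, hz]
  ring

/-- The two preceding limits add up to the Gaussian exponent: the Taylor term gives the variance,
the perturbation term the mean. Then (1 + zₙ/n)ⁿ → exp z when zₙ → z. -/
theorem tendsto_charFun_pi_withDensity {κ g : Ω → ℝ} (hκm : Measurable κ)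
    (hκ : MemLp κ 2 P) (hκ0 : ∫ x, κ x ∂P = 0) (hg : MemLp g 2 P)
    {h : ℕ → Ω → ℝ} (hm : ∀ n, Measurable (h n)) (hh : ∀ n, MemLp (h n) 2 P)
    (h0 : ∀ n, ∫ x, h n x ∂P = 0) (t : ℝ) (hpos : ∀ (n : ℕ) x, 0 ≤ 1 + t / √(n : ℝ) * h n x)
    (hconv : Tendsto (fun n => ∫ x, (h n x - g x) ^ 2 ∂P) atTop (𝓝 0)) (u : ℝ) :
    Tendsto (fun n : ℕ => (∫ x, Complex.exp (Complex.I * (((√(n : ℝ))⁻¹ * (u * κ x) : ℝ) : ℂ))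
        ∂(P.withDensity fun x => ENNReal.ofReal (1 + t / √(n : ℝ) * h n x))) ^ n) atTop
      (𝓝 (charFun (gaussianReal (t * ∫ x, κ x * g x ∂P) (∫ x, κ x ^ 2 ∂P).toNNReal) u)) := by
  have hA := (tendsto_natCast_mul_charFun_sub_one hκm hκ hκ0 u).add
    ((tendsto_sqrt_mul_integral_exp_sub_one_mul hκm hκ hg hh hconv u).const_mul (t : ℂ))
  set v : ℝ := ∫ x, κ x ^ 2 ∂P with hv
  have hv0 : 0 ≤ v := integral_nonneg fun x => sq_nonneg _
  have e : -((v : ℝ) : ℂ) * u ^ 2 / 2 +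
      t * (Complex.I * u * ((∫ x, κ x * g x ∂P : ℝ) : ℂ)) =
      u * ((t * ∫ x, κ x * g x ∂P : ℝ) : ℂ) * Complex.I
        - ((v.toNNReal : ℝ) : ℂ) * u ^ 2 / 2 := by
    rw [Real.coe_toNNReal _ hv0]; push_cast; ring
  rw [charFun_gaussianReal]
  rw [e] at hA
  have hB : Tendsto (fun n : ℕ => (n : ℂ) *
      ((∫ x, Complex.exp (Complex.I * (((√(n : ℝ))⁻¹ * (u * κ x) : ℝ) : ℂ))
        ∂(P.withDensity fun x => ENNReal.ofReal (1 + t / √(n : ℝ) * h n x))) - 1)) atTop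
      (𝓝 (u * ((t * ∫ x, κ x * g x ∂P : ℝ) : ℂ) * Complex.I
        - ((v.toNNReal : ℝ) : ℂ) * u ^ 2 / 2)) := by
    refine hA.congr' ?_
    filter_upwards [eventually_gt_atTop 0] with n hn
    have hn' : (0 : ℝ) < √(n : ℝ) := Real.sqrt_pos.2 (by exact_mod_cast hn)
    rw [integral_exp_withDensity hκm (hm n) ((hh n).integrable (by norm_num)) (h0 n)
      (t / √(n : ℝ)) _ u (hpos n)]
    have hs2 : (n : ℂ) = ((√(n : ℝ) : ℝ) : ℂ) * ((√(n : ℝ) : ℝ) : ℂ) := by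
      rw [← Complex.ofReal_mul, Real.mul_self_sqrt (Nat.cast_nonneg n)]; simp
    have hs0 : ((√(n : ℝ) : ℝ) : ℂ) ≠ 0 := by exact_mod_cast hn'.ne'
    have hs1 : (n : ℂ) * ((t / √(n : ℝ) : ℝ) : ℂ) = t * ((√(n : ℝ) : ℝ) : ℂ) := by
      rw [hs2, Complex.ofReal_div]; field_simp
    linear_combination (-hs1) * ∫ x, (Complex.exp (Complex.I *
      (((√(n : ℝ))⁻¹ * (u * κ x) : ℝ) : ℂ)) - 1) * (h n x : ℂ) ∂P
  refine (Complex.tendsto_one_add_pow_exp_of_tendsto hB).congr fun n => ?_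
  rw [add_sub_cancel]

/-- Lévy's continuity theorem followed by the portmanteau theorem; a nondegenerate normal law gives
no mass to the frontier {y}. -/
theorem tendsto_pi_real_le_of_tendsto_charFun {ρ : ℕ → Measure Ω}
    [∀ n, IsProbabilityMeasure (ρ n)] {κ : Ω → ℝ} (hκm : Measurable κ) {m : ℝ} {v : NNReal}
    (hv : v ≠ 0)
    (hlim : ∀ u : ℝ, Tendsto (fun n : ℕ =>
      (∫ x, Complex.exp (Complex.I * (((√(n : ℝ))⁻¹ * (u * κ x) : ℝ) : ℂ)) ∂(ρ n)) ^ n) atTop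
      (𝓝 (charFun (gaussianReal m v) u))) (y : ℝ) :
    Tendsto (fun n : ℕ => (Measure.pi fun _ : Fin n => ρ n).real
      {x | (√(n : ℝ))⁻¹ * ∑ i, κ (x i) ≤ y}) atTop (𝓝 (cdf (gaussianReal m v) y)) := by
  have hWm : ∀ n : ℕ, Measurable fun x : Fin n → Ω => (√(n : ℝ))⁻¹ * ∑ i, κ (x i) :=
    fun n => by fun_prop
  let ν : ℕ → ProbabilityMeasure ℝ := fun n =>
    ⟨(Measure.pi fun _ : Fin n => ρ n).map fun x => (√(n : ℝ))⁻¹ * ∑ i, κ (x i),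
      Measure.isProbabilityMeasure_map (hWm n).aemeasurable⟩
  let ν₀ : ProbabilityMeasure ℝ := ⟨gaussianReal m v, inferInstance⟩
  have hν : Tendsto ν atTop (𝓝 ν₀) :=
    ProbabilityMeasure.tendsto_of_tendsto_charFun fun u => (hlim u).congr fun n =>
      (charFun_pi_map_inv_sqrt_mul_sum (ρ n) hκm n u).symm
  have := nullSingletonClass_gaussianReal (μ := m) hv
  have hIic := ProbabilityMeasure.tendsto_measure_of_null_frontier_of_tendsto' hν
    (E := Set.Iic y) (by
      change gaussianReal m v (frontier (Set.Iic y)) = 0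
      rw [frontier_Iic]; exact measure_singleton y)
  rw [cdf_eq_real]
  refine ((ENNReal.tendsto_toReal (measure_ne_top _ _)).comp hIic).congr fun n => ?_
  exact congrArg ENNReal.toReal (Measure.map_apply (hWm n) measurableSet_Iic)

/-- Central limit theorem along local perturbations `(1 + (t / √n) hₙ) dP` of `P` with `hₙ → g` in
`L²`: the limit is normal with mean shifted by `t ⟨κ, g⟩`. -/
theorem tendsto_pi_withDensity_real_le {κ g : Ω → ℝ} (hκm : Measurable κ)
    (hκ : MemLp κ 2 P) (hκ0 : ∫ x, κ x ∂P = 0) (hσ : 0 < ∫ x, κ x ^ 2 ∂P) (hg : MemLp g 2 P)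
    {h : ℕ → Ω → ℝ} (hm : ∀ n, Measurable (h n)) (hh : ∀ n, MemLp (h n) 2 P)
    (h0 : ∀ n, ∫ x, h n x ∂P = 0) (t : ℝ) (hpos : ∀ (n : ℕ) x, 0 ≤ 1 + t / √(n : ℝ) * h n x)
    (hconv : Tendsto (fun n => ∫ x, (h n x - g x) ^ 2 ∂P) atTop (𝓝 0)) (y : ℝ) :
    Tendsto (fun n : ℕ => (Measure.pi fun _ : Fin n =>
        P.withDensity fun x => ENNReal.ofReal (1 + t / √(n : ℝ) * h n x)).real
          {x | (√(n : ℝ))⁻¹ * ∑ i, κ (x i) ≤ y}) atTop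
      (𝓝 (cdf (gaussianReal (t * ∫ x, κ x * g x ∂P) (∫ x, κ x ^ 2 ∂P).toNNReal) y)) := by
  have hlim := tendsto_charFun_pi_withDensity hκm hκ hκ0 hg hm hh h0 t hpos hconv
  have hRp : ∀ n : ℕ, IsProbabilityMeasure
      (P.withDensity fun x => ENNReal.ofReal (1 + t / √(n : ℝ) * h n x)) := fun n => by
    have hi := ((hh n).integrable (by norm_num : (1 : ENNReal) ≤ 2)).const_mul (t / √(n : ℝ))
    refine isProbabilityMeasure_withDensity_ofReal (hpos n) ((integrable_const 1).add hi) ?_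
    rw [integral_add (integrable_const 1) hi, integral_const_mul, h0]; simp
  exact tendsto_pi_real_le_of_tendsto_charFun hκm (Real.toNNReal_pos.2 hσ).ne' hlim y

end CentralLimit

/-! ### Root densities and the Hellinger distance to a local alternative. -/

section Hellinger

variable {Ω : Type*} [MeasurableSpace Ω]

theorem withDensity_sq_sqrt_rnDeriv {P μ : Measure Ω} [IsFiniteMeasure P] [SigmaFinite μ]
    (h : P ≪ μ) : μ.withDensity (fun x => ENNReal.ofReal (√((P.rnDeriv μ x).toReal) ^ 2)) = P := by
  rw [← Measure.withDensity_rnDeriv_eq P μ h]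
  refine withDensity_congr_ae ?_
  rw [Measure.withDensity_rnDeriv_eq P μ h]
  filter_upwards [Measure.rnDeriv_lt_top P μ] with x hx
  rw [Real.sq_sqrt ENNReal.toReal_nonneg, ENNReal.ofReal_toReal hx.ne]

/-- Multiplication by the root density p embeds L²(P) isometrically in L²(μ), so computations under
P and under the dominating measure can be exchanged. -/
theorem memLp_two_mul_of_withDensity {μ P : Measure Ω} {p : Ω → ℝ} (hpm : Measurable p)
    (hP : μ.withDensity (fun x => ENNReal.ofReal (p x ^ 2)) = P) {f : Ω → ℝ} (hfm : Measurable f)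
    (hf : MemLp f 2 P) :
    MemLp (fun x => f x * p x) 2 μ ∧ ∫ x, (f x * p x) ^ 2 ∂μ = ∫ x, f x ^ 2 ∂P := by
  have hm : Measurable fun x => ENNReal.ofReal (p x ^ 2) := by fun_prop
  have e : ∀ x, (ENNReal.ofReal (p x ^ 2)).toReal • f x ^ 2 = (f x * p x) ^ 2 := fun x => by
    rw [ENNReal.toReal_ofReal (sq_nonneg _), smul_eq_mul]; ring
  constructor
  · rw [memLp_two_iff_integrable_sq (by fun_prop)]
    have h := hf.integrable_sq
    rw [← hP, integrable_withDensity_iff_integrable_smul' hm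
      (ae_of_all _ fun _ => ENNReal.ofReal_lt_top)] at h
    simpa only [e] using h
  · rw [← hP, integral_withDensity_eq_integral_toReal_smul hm
      (ae_of_all _ fun _ => ENNReal.ofReal_lt_top)]
    simp only [e]

theorem integral_add_sq_le {μ : Measure Ω} {f g : Ω → ℝ} (hf : MemLp f 2 μ) (hg : MemLp g 2 μ) :
    ∫ x, (f x + g x) ^ 2 ∂μ ≤ 2 * ∫ x, f x ^ 2 ∂μ + 2 * ∫ x, g x ^ 2 ∂μ := by
  rw [← integral_const_mul, ← integral_const_mul,
    ← integral_add (hf.integrable_sq.const_mul 2) (hg.integrable_sq.const_mul 2)]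
  refine integral_mono (hf.add hg).integrable_sq
    ((hf.integrable_sq.const_mul 2).add (hg.integrable_sq.const_mul 2)) fun x => ?_
  change (f x + g x) ^ 2 ≤ 2 * f x ^ 2 + 2 * g x ^ 2
  nlinarith [sq_nonneg (f x - g x)]

theorem withDensity_rootDensity_left (P Q : ProbabilityMeasure Ω) :
    ((P : Measure Ω) + (Q : Measure Ω)).withDensity (fun x => ENNReal.ofReal
      (√(((P : Measure Ω).rnDeriv ((P : Measure Ω) + (Q : Measure Ω)) x).toReal) ^ 2)) = P :=
  withDensity_sq_sqrt_rnDeriv (Measure.absolutelyContinuous_of_le (Measure.le_add_right le_rfl))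

theorem withDensity_rootDensity_right (P Q : ProbabilityMeasure Ω) :
    ((P : Measure Ω) + (Q : Measure Ω)).withDensity (fun x => ENNReal.ofReal
      (√(((Q : Measure Ω).rnDeriv ((P : Measure Ω) + (Q : Measure Ω)) x).toReal) ^ 2)) = Q :=
  withDensity_sq_sqrt_rnDeriv (Measure.absolutelyContinuous_of_le (Measure.le_add_left le_rfl))

theorem memLp_two_sub_mul_of_withDensity {μ P Q : Measure Ω} [IsFiniteMeasure P]
    [IsFiniteMeasure Q] {p q : Ω → ℝ} (hpm : Measurable p) (hqm : Measurable q)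
    (hP : μ.withDensity (fun x => ENNReal.ofReal (p x ^ 2)) = P)
    (hQ : μ.withDensity (fun x => ENNReal.ofReal (q x ^ 2)) = Q) {f : Ω → ℝ} (hfm : Measurable f)
    (hf : MemLp f 2 P) : MemLp (fun x => q x - f x * p x) 2 μ := by
  have h2 := (memLp_two_mul_of_withDensity hqm hQ (f := fun _ => 1) measurable_const
    (memLp_const (1 : ℝ))).1
  simp only [one_mul] at h2
  exact h2.sub (memLp_two_mul_of_withDensity hpm hP hfm hf).1

theorem memLp_rootRemainder (P Q : ProbabilityMeasure Ω) (g : Lp ℝ 2 (P : Measure Ω)) (s : ℝ) :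
    MemLp (rootRemainder P Q g s) 2 ((P : Measure Ω) + (Q : Measure Ω)) := by
  have hgm := (Lp.stronglyMeasurable g).measurable
  have h1 : MemLp (fun _ : Ω => (1 : ℝ)) 2 (P : Measure Ω) := memLp_const 1
  have hf : MemLp (fun x => 1 + s / 2 * g x) 2 (P : Measure Ω) :=
    h1.add ((Lp.memLp g).const_mul (s / 2))
  exact memLp_two_sub_mul_of_withDensity (by fun_prop) (by fun_prop)
    (withDensity_rootDensity_left P Q) (withDensity_rootDensity_right P Q)
    (f := fun x => 1 + s / 2 * g x) (by fun_prop) hf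

/-- Comparison of the product laws of `Q` and of `w dP`. -/
theorem abs_iidLaw_real_sub_le (P Q : ProbabilityMeasure Ω) (g : Lp ℝ 2 (P : Measure Ω)) (s : ℝ)
    {w : Ω → ℝ} (hwm : Measurable w) (hw0 : ∀ x, 0 ≤ w x) (hwi : Integrable w (P : Measure Ω))
    (hw1 : ∫ x, w x ∂(P : Measure Ω) = 1) (n : ℕ) {A : Set (Fin n → Ω)} (hA : MeasurableSet A) :
    |(iidLaw Q n).real A - (Measure.pi fun _ : Fin n =>
        (P : Measure Ω).withDensity fun x => ENNReal.ofReal (w x)).real A| ≤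
      2 * √(n * (2 * ∫ x, rootRemainder P Q g s x ^ 2 ∂((P : Measure Ω) + (Q : Measure Ω)) +
        2 * ∫ x, (√(w x) - 1 - s / 2 * g x) ^ 2 ∂(P : Measure Ω))) := by
  set μ : Measure Ω := (P : Measure Ω) + (Q : Measure Ω) with hμ
  set p : Ω → ℝ := fun x => √(((P : Measure Ω).rnDeriv μ x).toReal) with hp
  set q : Ω → ℝ := fun x => √(((Q : Measure Ω).rnDeriv μ x).toReal) with hq
  have hpm : Measurable p := by fun_prop
  have hqm : Measurable q := by fun_prop
  have hP : μ.withDensity (fun x => ENNReal.ofReal (p x ^ 2)) = P :=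
    withDensity_rootDensity_left P Q
  have hQ : μ.withDensity (fun x => ENNReal.ofReal (q x ^ 2)) = Q :=
    withDensity_rootDensity_right P Q
  have hgm := (Lp.stronglyMeasurable g).measurable
  have hswm : Measurable fun x => √(w x) := by fun_prop
  have hsw : MemLp (fun x => √(w x)) 2 (P : Measure Ω) := by
    rw [memLp_two_iff_integrable_sq hswm.aestronglyMeasurable]
    simpa only [Real.sq_sqrt (hw0 _)] using hwi
  have hq2 := memLp_two_mul_of_withDensity hqm hQ (f := fun _ => 1)
    (by fun_prop) (memLp_const 1)
  simp only [one_mul, one_pow, integral_const, probReal_univ, smul_eq_mul, mul_one] at hq2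
  have hv2 := memLp_two_mul_of_withDensity hpm hP hswm hsw
  simp only [Real.sq_sqrt (hw0 _), hw1] at hv2
  have hD : MemLp (fun x => √(w x) - 1 - s / 2 * g x) 2 (P : Measure Ω) :=
    (hsw.sub (memLp_const 1)).sub ((Lp.memLp g).const_mul _)
  have hD2 := memLp_two_mul_of_withDensity hpm hP (by fun_prop) hD
  have hR : (P : Measure Ω).withDensity (fun x => ENNReal.ofReal (w x)) =
      μ.withDensity fun x => ENNReal.ofReal ((√(w x) * p x) ^ 2) := by
    conv_lhs => rw [← hP]
    rw [← withDensity_mul _ (by fun_prop) (by fun_prop)]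
    congr 1; ext x
    rw [Pi.mul_apply, ← ENNReal.ofReal_mul (sq_nonneg _), mul_pow, Real.sq_sqrt (hw0 x), mul_comm]
  have hspm : Measurable fun x => √(w x) * p x := hswm.mul hpm
  have h := abs_pi_real_sub_le (μ := μ) hqm hspm (fun x => Real.sqrt_nonneg _)
    (fun x => mul_nonneg (Real.sqrt_nonneg _) (Real.sqrt_nonneg _)) hq2.1 hv2.1 hq2.2 hv2.2 n hA
  rw [hQ] at h
  rw [iidLaw, hR]
  refine h.trans ?_
  gcongr
  have h3 := integral_add_sq_le (memLp_rootRemainder P Q g s) hD2.1.neg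
  -- Both root densities are compared with (1 + (s/2) g) p; the second difference is p times a
  -- function on L²(P).
  have e : ∀ x, q x - √(w x) * p x =
      rootRemainder P Q g s x + (-fun x => (√(w x) - 1 - s / 2 * g x) * p x) x := by
    intro x
    simp only [rootRemainder, Pi.neg_apply, ← hμ, hp, hq]
    ring
  have e2 : ∫ x, (-fun x => (√(w x) - 1 - s / 2 * g x) * p x) x ^ 2 ∂μ =
      ∫ x, (√(w x) - 1 - s / 2 * g x) ^ 2 ∂(P : Measure Ω) := by
    rw [← hD2.2]
    simp only [Pi.neg_apply, neg_sq]
  rw [e2] at h3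
  simp only [← e] at h3
  exact h3

theorem IsLocalAlternative.tendsto_integral_sq {𝓜 : Set (ProbabilityMeasure Ω)}
    {P : ProbabilityMeasure Ω} {g : Lp ℝ 2 (P : Measure Ω)} {Q : ℝ → ProbabilityMeasure Ω}
    (h : IsLocalAlternative 𝓜 P g Q) :
    Tendsto (fun s => (∫ x, rootRemainder P (Q s) g s x ^ 2
      ∂((P : Measure Ω) + (Q s : Measure Ω))) / s ^ 2) (𝓝[>] 0) (𝓝 0) := by
  have h1 := ((ENNReal.tendsto_toReal ENNReal.zero_ne_top).comp h.2).pow 2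
  simp only [ENNReal.toReal_zero, ne_eq, OfNat.ofNat_ne_zero, not_false_eq_true, zero_pow] at h1
  refine h1.congr' ?_
  filter_upwards [self_mem_nhdsWithin] with s hs
  have hs : (0 : ℝ) < s := hs
  simp only [Function.comp_apply]
  have h0 : 0 ≤ ∫ x, rootRemainder P (Q s) g s x ^ 2 ∂((P : Measure Ω) + (Q s : Measure Ω)) :=
    integral_nonneg fun x => sq_nonneg _
  rw [(memLp_rootRemainder P (Q s) g s).eLpNorm_eq_integral_rpow_norm (by norm_num) (by norm_num),
    ENNReal.toReal_div, ENNReal.toReal_ofReal hs.le, ENNReal.toReal_ofReal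
      (Real.rpow_nonneg (integral_nonneg fun x => by positivity) _), div_pow]
  congr 1
  have : (ENNReal.toReal 2)⁻¹ = (1 / 2 : ℝ) := by norm_num
  rw [this, ← Real.sqrt_eq_rpow]
  simp only [ENNReal.toReal_ofNat, Real.rpow_ofNat, Real.norm_eq_abs, sq_abs]
  exact Real.sq_sqrt h0

end Hellinger

/-! ### Truncated and centered scores. -/

section ClampedScore

variable {Ω : Type*}

/-- The truncation level of order `s ^ (-1/2)`. -/
noncomputable def clampLevel (s : ℝ) : ℝ := (4 * √s * (1 + √s))⁻¹

/-- The function `g` truncated to `[-M, M]`, with `M = clampLevel s`. -/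
noncomputable def clamped (g : Ω → ℝ) (s : ℝ) (x : Ω) : ℝ :=
  max (-clampLevel s) (min (g x) (clampLevel s))

theorem clampLevel_nonneg (s : ℝ) : 0 ≤ clampLevel s := by
  unfold clampLevel; positivity

theorem abs_clamped_le_clampLevel (g : Ω → ℝ) (s : ℝ) (x : Ω) :
    |clamped g s x| ≤ clampLevel s := by
  have := clampLevel_nonneg s
  exact abs_le.2 ⟨le_max_left _ _, max_le (by linarith) (min_le_right _ _)⟩

theorem abs_clamped_le_abs (g : Ω → ℝ) (s : ℝ) (x : Ω) : |clamped g s x| ≤ |g x| := by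
  have h0 := clampLevel_nonneg s
  unfold clamped
  rcases le_total (g x) (clampLevel s) with h | h
  · rw [min_eq_left h]
    rcases le_total (-clampLevel s) (g x) with h' | h'
    · rw [max_eq_right h']
    · rw [max_eq_left h', abs_neg, abs_of_nonneg h0, abs_of_nonpos (by linarith)]; linarith
  · rw [min_eq_right h, max_eq_right (by linarith), abs_of_nonneg h0]
    exact h.trans (le_abs_self _)

theorem clamped_eq_of_abs_le {g : Ω → ℝ} {s : ℝ} {x : Ω} (h : |g x| ≤ clampLevel s) :
    clamped g s x = g x := by
  rw [abs_le] at h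
  unfold clamped
  rw [min_eq_left h.2, max_eq_right h.1]

/-- The 2 pays for the truncated function and its mean. The factor 1 + √s in the level keeps the
bound below 1/2 for every s ≥ 0, so 1 + s h is a density without restriction to small s; the order
√s makes the quadratic error of the square root negligible. -/
theorem mul_clampLevel_le {s : ℝ} (hs : 0 ≤ s) :
    s * (2 * clampLevel s) ≤ √s / (2 * (1 + √s)) := by
  rcases hs.eq_or_lt with rfl | hs
  · simp
  · have h : 0 < √s := Real.sqrt_pos.2 hs
    have e : s = √s * √s := (Real.mul_self_sqrt hs.le).symm
    refine le_of_eq ?_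
    unfold clampLevel
    conv_lhs => rw [show s * (2 * (4 * √s * (1 + √s))⁻¹) =
      (√s * √s) * (2 * (4 * √s * (1 + √s))⁻¹) by rw [← e]]
    field_simp
    ring

variable [MeasurableSpace Ω] {P : Measure Ω}

/-- The truncation of `g`, centered under `P`. -/
noncomputable def clampedScore (P : Measure Ω) (g : Ω → ℝ) (s : ℝ) (x : Ω) : ℝ :=
  clamped g s x - ∫ y, clamped g s y ∂P

theorem measurable_clamped {g : Ω → ℝ} (hg : Measurable g) (s : ℝ) : Measurable (clamped g s) := by
  unfold clamped; fun_prop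

theorem measurable_clampedScore {g : Ω → ℝ} (hg : Measurable g) (s : ℝ) :
    Measurable (clampedScore P g s) := (measurable_clamped hg s).sub_const _

theorem memLp_clamped {g : Ω → ℝ} (hgm : Measurable g) (hg : MemLp g 2 P) (s : ℝ) :
    MemLp (clamped g s) 2 P :=
  hg.mono (measurable_clamped hgm s).aestronglyMeasurable
    (ae_of_all _ fun x => abs_clamped_le_abs g s x)

variable [IsProbabilityMeasure P]

theorem memLp_clampedScore {g : Ω → ℝ} (hgm : Measurable g) (hg : MemLp g 2 P) (s : ℝ) :
    MemLp (clampedScore P g s) 2 P := (memLp_clamped hgm hg s).sub (memLp_const _)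

theorem integral_clampedScore {g : Ω → ℝ} (hgm : Measurable g) (hg : MemLp g 2 P) (s : ℝ) :
    ∫ x, clampedScore P g s x ∂P = 0 := by
  unfold clampedScore
  rw [integral_sub ((memLp_clamped hgm hg s).integrable (by norm_num)) (integrable_const _)]
  simp

theorem abs_mul_clampedScore_le (g : Ω → ℝ) {s : ℝ} (hs : 0 ≤ s) (x : Ω) :
    |s * clampedScore P g s x| ≤ √s / (2 * (1 + √s)) := by
  refine le_trans ?_ (mul_clampLevel_le hs)
  rw [abs_mul, abs_of_nonneg hs]
  refine mul_le_mul_of_nonneg_left ?_ hs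
  have h1 := abs_clamped_le_clampLevel g s x
  have h2 : |∫ y, clamped g s y ∂P| ≤ clampLevel s := by
    have := norm_integral_le_of_norm_le_const (μ := P) (f := clamped g s)
      (ae_of_all _ fun x => abs_clamped_le_clampLevel g s x)
    simpa using this
  exact (abs_sub _ _).trans (by linarith)

theorem half_le_one_add_mul_clampedScore (g : Ω → ℝ) {s : ℝ} (hs : 0 ≤ s) (x : Ω) :
    1 / 2 ≤ 1 + s * clampedScore P g s x := by
  have h1 := abs_mul_clampedScore_le (P := P) g hs x
  have h2 : √s / (2 * (1 + √s)) ≤ 1 / 2 := by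
    rw [div_le_div_iff₀ (by positivity) (by norm_num)]
    nlinarith [Real.sqrt_nonneg s]
  linarith [(abs_le.1 (h1.trans h2)).1]

theorem integral_sub_integral_sq_le {f : Ω → ℝ} (hf : MemLp f 2 P) :
    ∫ x, (f x - ∫ y, f y ∂P) ^ 2 ∂P ≤ ∫ x, f x ^ 2 ∂P := by
  have h := integral_add_const_mul_sq hf (memLp_const (1 : ℝ)) (-∫ y, f y ∂P)
  simp only [mul_one, one_pow, integral_const, probReal_univ, smul_eq_mul,
    ← sub_eq_add_neg] at h
  rw [h]
  nlinarith [sq_nonneg (∫ y, f y ∂P)]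

theorem integral_clampedScore_sq_le {g : Ω → ℝ} (hgm : Measurable g) (hg : MemLp g 2 P) (s : ℝ) :
    ∫ x, clampedScore P g s x ^ 2 ∂P ≤ ∫ x, g x ^ 2 ∂P :=
  (integral_sub_integral_sq_le (memLp_clamped hgm hg s)).trans <|
    integral_mono (memLp_clamped hgm hg s).integrable_sq hg.integrable_sq fun x =>
      sq_le_sq.2 (abs_clamped_le_abs g s x)

theorem tendsto_clampLevel : Tendsto clampLevel (𝓝[>] 0) atTop := by
  have h : Tendsto (fun s : ℝ => 4 * √s * (1 + √s)) (𝓝[>] 0) (𝓝[>] 0) := by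
    refine tendsto_nhdsWithin_iff.2 ⟨?_, ?_⟩
    · have : ContinuousAt (fun s : ℝ => 4 * √s * (1 + √s)) 0 := by fun_prop
      have h := this.tendsto.mono_left (nhdsWithin_le_nhds (s := Set.Ioi 0))
      simpa using h
    · filter_upwards [self_mem_nhdsWithin] with s hs
      have : 0 < √s := Real.sqrt_pos.2 hs
      exact Set.mem_Ioi.2 (by positivity)
  exact tendsto_inv_nhdsGT_zero.comp h

/-- The truncation level tends to infinity and 4g² dominates. As g has mean zero, `clampedScore P g
s - g` is the centering of `clamped g s - g`, and centering does not increase the second moment. -/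
theorem tendsto_integral_clampedScore_sub_sq {g : Ω → ℝ} (hgm : Measurable g) (hg : MemLp g 2 P)
    (hg0 : ∫ x, g x ∂P = 0) :
    Tendsto (fun s => ∫ x, (clampedScore P g s x - g x) ^ 2 ∂P) (𝓝[>] 0) (𝓝 0) := by
  have h1 : Tendsto (fun s => ∫ x, (clamped g s x - g x) ^ 2 ∂P) (𝓝[>] 0)
      (𝓝 (∫ _, (0 : ℝ) ∂P)) := by
    refine tendsto_integral_filter_of_dominated_convergence (fun x => 4 * g x ^ 2)
      (Eventually.of_forall fun s => ?_) (Eventually.of_forall fun s => ae_of_all _ fun x => ?_)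
      (hg.integrable_sq.const_mul 4) (ae_of_all _ fun x => ?_)
    · have := measurable_clamped hgm s
      fun_prop
    · have h := abs_clamped_le_abs g s x
      have h' : |clamped g s x - g x| ≤ 2 * |g x| := (abs_sub _ _).trans (by linarith)
      rw [Real.norm_eq_abs, abs_of_nonneg (sq_nonneg _), ← sq_abs, ← sq_abs (g x)]
      nlinarith [abs_nonneg (clamped g s x - g x)]
    · refine tendsto_const_nhds.congr' ?_
      filter_upwards [tendsto_clampLevel.eventually_ge_atTop |g x|] with s hs
      simp [clamped_eq_of_abs_le hs]
  rw [integral_zero] at h1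
  refine squeeze_zero (fun s => integral_nonneg fun x => sq_nonneg _) (fun s => ?_) h1
  have h2 := integral_sub_integral_sq_le ((memLp_clamped hgm hg s).sub hg)
  simp only [Pi.sub_apply] at h2
  rw [integral_sub ((memLp_clamped hgm hg s).integrable (by norm_num))
    (hg.integrable (by norm_num)), hg0, sub_zero] at h2
  refine le_trans (le_of_eq ?_) h2
  congr 1; ext x
  unfold clampedScore
  ring

/-- With r = √(1 + y), the left side is (r - 1)²/2, while y² = (r - 1)²(r + 1)² and r + 1 ≥ 1. -/
theorem abs_sqrt_one_add_sub_le {y : ℝ} (hy : -1 ≤ y) : |√(1 + y) - 1 - y / 2| ≤ y ^ 2 / 2 := by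
  set r := √(1 + y) with hr
  have h0 : 0 ≤ r := Real.sqrt_nonneg _
  have h1 : r ^ 2 = 1 + y := Real.sq_sqrt (by linarith)
  have hy' : y = r ^ 2 - 1 := by linarith
  have e : r - 1 - y / 2 = -((r - 1) ^ 2 / 2) := by rw [hy']; ring
  rw [e, abs_neg, abs_of_nonneg (by positivity), hy']
  have : (r ^ 2 - 1) ^ 2 = (r - 1) ^ 2 * (r + 1) ^ 2 := by ring
  rw [this]
  have : (1 : ℝ) ≤ (r + 1) ^ 2 := by nlinarith
  nlinarith [sq_nonneg (r - 1)]

theorem integral_sqrt_one_add_clampedScore_le {g : Ω → ℝ} (hgm : Measurable g) (hg : MemLp g 2 P)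
    {s : ℝ} (hs : 0 ≤ s) :
    ∫ x, (√(1 + s * clampedScore P g s x) - 1 - s / 2 * g x) ^ 2 ∂P ≤
      s ^ 2 * (s / 8 * ∫ x, g x ^ 2 ∂P + 1 / 2 * ∫ x, (clampedScore P g s x - g x) ^ 2 ∂P) := by
  set h := clampedScore P g s
  have hh : MemLp h 2 P := memLp_clampedScore hgm hg s
  have hd : MemLp (fun x => h x - g x) 2 P := hh.sub hg
  have hb : ∀ x, (√(1 + s * h x) - 1 - s / 2 * g x) ^ 2 ≤
      s ^ 2 * (s / 8 * h x ^ 2 + 1 / 2 * (h x - g x) ^ 2) := by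
    intro x
    have h1 := abs_sqrt_one_add_sub_le (y := s * h x)
      (by linarith [half_le_one_add_mul_clampedScore (P := P) g hs x])
    have h2 : (s * h x) ^ 2 ≤ s / 4 := by
      have h3 := abs_mul_clampedScore_le (P := P) g hs x
      have h4 : √s / (2 * (1 + √s)) ≤ √s / 2 := by
        gcongr
        linarith [Real.sqrt_nonneg s]
      have h5 := pow_le_pow_left₀ (abs_nonneg _) (h3.trans h4) 2
      rwa [sq_abs, div_pow, Real.sq_sqrt hs, show (2 : ℝ) ^ 2 = 4 by norm_num] at h5
    -- The integrand is (a + (s/2)(h - g))² ≤ 2a² + (s²/2)(h - g)². From |a| ≤ (sh)²/2 and (sh)² ≤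
    -- s/4 comes a² ≤ (s/16)(sh)², whence the constant s/8.
    set a := √(1 + s * h x) - 1 - s * h x / 2 with ha
    have h6 : a ^ 2 ≤ ((s * h x) ^ 2 / 2) ^ 2 := by
      rw [← sq_abs]; exact pow_le_pow_left₀ (abs_nonneg _) h1 2
    have h7 : √(1 + s * h x) - 1 - s / 2 * g x = a + s / 2 * (h x - g x) := by rw [ha]; ring
    rw [h7]
    have h8 : ((s * h x) ^ 2 / 2) ^ 2 ≤ s / 16 * (s * h x) ^ 2 := by
      nlinarith [sq_nonneg (s * h x)]
    nlinarith [sq_nonneg (a - s / 2 * (h x - g x))]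
  have i1 : Integrable (fun x => s / 8 * h x ^ 2 + 1 / 2 * (h x - g x) ^ 2) P :=
    (hh.integrable_sq.const_mul _).add (hd.integrable_sq.const_mul _)
  calc ∫ x, (√(1 + s * h x) - 1 - s / 2 * g x) ^ 2 ∂P
      ≤ ∫ x, s ^ 2 * (s / 8 * h x ^ 2 + 1 / 2 * (h x - g x) ^ 2) ∂P :=
        integral_mono_of_nonneg (ae_of_all _ fun x => sq_nonneg _) (i1.const_mul _)
          (ae_of_all _ hb)
    _ = s ^ 2 * (s / 8 * ∫ x, h x ^ 2 ∂P + 1 / 2 * ∫ x, (h x - g x) ^ 2 ∂P) := by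
        rw [integral_const_mul, integral_add (hh.integrable_sq.const_mul _)
          (hd.integrable_sq.const_mul _), integral_const_mul, integral_const_mul]
    _ ≤ _ := by
        gcongr s ^ 2 * (s / 8 * ?_ + _)
        exact integral_clampedScore_sq_le hgm hg s

end ClampedScore

/-! ### The tangent set is stable under positive scaling. -/

section TangentCone

variable {Ω : Type*} [MeasurableSpace Ω]

theorem ae_rnDeriv_ne_zero_imp {P μ : Measure Ω} [SigmaFinite P] [SigmaFinite μ] (hac : P ≪ μ)
    {p : Ω → Prop} (h : ∀ᵐ x ∂P, p x) : ∀ᵐ x ∂μ, P.rnDeriv μ x ≠ 0 → p x := by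
  rwa [← Measure.withDensity_rnDeriv_eq _ _ hac,
    ae_withDensity_iff (Measure.measurable_rnDeriv _ _)] at h

/-- The representatives of `r • g` and of r times `g` agree only P-almost everywhere; where dP/dμ
vanishes, the root density removes the discrepancy. -/
theorem rootRemainder_smul_ae_eq (P Q : ProbabilityMeasure Ω) (g : Lp ℝ 2 (P : Measure Ω))
    (r s : ℝ) :
    rootRemainder P Q (r • g) s =ᵐ[(P : Measure Ω) + (Q : Measure Ω)]
      rootRemainder P Q g (r * s) := by
  have h1 : ∀ᵐ x ∂(P : Measure Ω), (r • g : Lp ℝ 2 (P : Measure Ω)) x = r * g x :=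
    Lp.coeFn_smul r g
  have hac : (P : Measure Ω) ≪ (P : Measure Ω) + (Q : Measure Ω) :=
    Measure.absolutelyContinuous_of_le (Measure.le_add_right le_rfl)
  filter_upwards [ae_rnDeriv_ne_zero_imp hac h1] with x hx
  simp only [rootRemainder]
  by_cases h0 : (P : Measure Ω).rnDeriv ((P : Measure Ω) + (Q : Measure Ω)) x = 0
  · simp [h0]
  · rw [hx h0]; ring

theorem tendsto_const_mul_nhdsGT_zero {r : ℝ} (hr : 0 < r) :
    Tendsto (fun s : ℝ => r * s) (𝓝[>] 0) (𝓝[>] 0) := by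
  refine tendsto_nhdsWithin_iff.2 ⟨?_, ?_⟩
  · have h : ContinuousAt (fun s : ℝ => r * s) 0 := by fun_prop
    simpa using h.tendsto.mono_left (nhdsWithin_le_nhds (s := Set.Ioi 0))
  · filter_upwards [self_mem_nhdsWithin] with s hs
    exact mul_pos hr hs

theorem IsLocalAlternative.smul {𝓜 : Set (ProbabilityMeasure Ω)} {P : ProbabilityMeasure Ω}
    {g : Lp ℝ 2 (P : Measure Ω)} {Q : ℝ → ProbabilityMeasure Ω}
    (h : IsLocalAlternative 𝓜 P g Q) {r : ℝ} (hr : 0 < r) :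
    IsLocalAlternative 𝓜 P (r • g) fun s => Q (r * s) := by
  refine ⟨(tendsto_const_mul_nhdsGT_zero hr).eventually h.1, ?_⟩
  have h1 := ENNReal.Tendsto.mul_const (h.2.comp (tendsto_const_mul_nhdsGT_zero hr))
    (b := ENNReal.ofReal r) (Or.inr ENNReal.ofReal_ne_top)
  rw [zero_mul] at h1
  refine h1.congr' ?_
  filter_upwards [self_mem_nhdsWithin] with s hs
  have hr0 : ENNReal.ofReal r ≠ 0 := (ENNReal.ofReal_pos.2 hr).ne'
  simp only [Function.comp_apply]
  rw [eLpNorm_congr_ae (rootRemainder_smul_ae_eq P (Q (r * s)) g r s),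
    ENNReal.ofReal_mul hr.le, div_eq_mul_inv, div_eq_mul_inv,
    ENNReal.mul_inv (Or.inl hr0) (Or.inl ENNReal.ofReal_ne_top), mul_assoc]
  congr 1
  rw [mul_comm (ENNReal.ofReal r)⁻¹, mul_assoc,
    ENNReal.inv_mul_cancel hr0 ENNReal.ofReal_ne_top, mul_one]

theorem smul_mem_tangentSet {𝓜 : Set (ProbabilityMeasure Ω)} {P : ProbabilityMeasure Ω}
    {g : Lp ℝ 2 (P : Measure Ω)} (hg : g ∈ tangentSet 𝓜 P) {r : ℝ} (hr : 0 < r) :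
    r • g ∈ tangentSet 𝓜 P := by
  obtain ⟨h0, Q, hQ⟩ := hg
  refine ⟨?_, _, hQ.smul hr⟩
  rw [integral_congr_ae (Lp.coeFn_smul r g)]
  simp [integral_const_mul, h0]

end TangentCone

/-! ### Projection on a convex cone and the distinguishing direction. -/

section ConeProjection

variable {E : Type*} [NormedAddCommGroup E] [InnerProductSpace ℝ E] {G : Set E} {κ a : E}

theorem IsProjectionOn.inner_sub_le_zero (hG : Convex ℝ G) (h : IsProjectionOn G κ a) {g : E}
    (hg : g ∈ G) : inner ℝ (κ - a) (g - a) ≤ 0 := by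
  have : Nonempty G := ⟨⟨a, h.1⟩⟩
  refine (norm_eq_iInf_iff_real_inner_le_zero hG h.1).1 (le_antisymm ?_ ?_) g hg
  · exact le_ciInf fun w => h.2 w w.2
  · exact ciInf_le ⟨0, by rintro _ ⟨w, rfl⟩; exact norm_nonneg _⟩ (⟨a, h.1⟩ : G)

/-- Test the variational inequality with the multiples 2a and a/2, which lie on either side of a. -/
theorem IsProjectionOn.inner_self_eq_zero (hG : Convex ℝ G)
    (hcone : ∀ g ∈ G, ∀ r : ℝ, 0 < r → r • g ∈ G) (h : IsProjectionOn G κ a) :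
    inner ℝ (κ - a) a = 0 := by
  have h1 := h.inner_sub_le_zero hG (hcone a h.1 2 (by norm_num))
  have h2 := h.inner_sub_le_zero hG (hcone a h.1 (1 / 2) (by norm_num))
  rw [inner_sub_right, inner_smul_right] at h1 h2
  linarith

/-- If the projection `a` of `κ` on a convex cone is nonzero and differs from the projection on the
closed linear span, then there is a direction in the cone that distinguishes `κ` from `a`. -/
theorem IsProjectionOn.exists_inner_lt [CompleteSpace E] (hG : Convex ℝ G)
    (hcone : ∀ g ∈ G, ∀ r : ℝ, 0 < r → r • g ∈ G) (h : IsProjectionOn G κ a) (ha : a ≠ 0)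
    (hne : spanProjection G κ ≠ a) :
    ∃ g ∈ G, 0 < inner ℝ κ g ∧ inner ℝ κ g < inner ℝ a g := by
  have hself := h.inner_self_eq_zero hG hcone
  have hle : ∀ g ∈ G, inner ℝ (κ - a) g ≤ 0 := fun g hg => by
    have h1 := h.inner_sub_le_zero hG hg
    rw [inner_sub_right] at h1
    linarith
  -- Otherwise κ - a is orthogonal to all of G, hence to its closed span, and a would be the span
  -- projection.
  obtain ⟨g, hg, hlt⟩ : ∃ g ∈ G, inner ℝ (κ - a) g < 0 := by
    by_contra! hcon
    refine hne (Submodule.eq_starProjection_of_mem_orthogonal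
      (Submodule.le_topologicalClosure _ (Submodule.subset_span h.1)) ?_)
    rw [Submodule.orthogonal_closure]
    refine (Submodule.mem_orthogonal' _ _).2 fun u hu => ?_
    induction hu using Submodule.span_induction with
    | mem x hx => exact le_antisymm (hle x hx) (hcon x hx)
    | zero => exact inner_zero_right _
    | add x y _ _ hx hy => rw [inner_add_right, hx, hy, add_zero]
    | smul c x _ hx => rw [inner_smul_right, hx, mul_zero]
  have hκa : inner ℝ κ a = ‖a‖ ^ 2 := by
    rw [inner_sub_left, real_inner_self_eq_norm_sq] at hself
    linarith
  have hpos : 0 < ‖a‖ ^ 2 := by positivity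
  -- Any θ > 0 makes ⟨κ - a, (1 - θ)a + θg⟩ = θ⟨κ - a, g⟩ negative; a small θ keeps the product with
  -- κ near ⟨κ, a⟩ = ‖a‖² > 0.
  have hcont : Tendsto (fun θ : ℝ => (1 - θ) * ‖a‖ ^ 2 + θ * inner ℝ κ g) (𝓝[>] 0)
      (𝓝 (‖a‖ ^ 2)) := by
    have : ContinuousAt (fun θ : ℝ => (1 - θ) * ‖a‖ ^ 2 + θ * inner ℝ κ g) 0 := by fun_prop
    simpa using this.tendsto.mono_left (nhdsWithin_le_nhds (s := Set.Ioi 0))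
  obtain ⟨θ, ⟨hθ, hθ0⟩, hθ1⟩ := ((hcont.eventually (lt_mem_nhds hpos)).and
    (self_mem_nhdsWithin : Set.Ioi (0 : ℝ) ∈ 𝓝[>] 0)).and
    (mem_nhdsWithin_of_mem_nhds (Iio_mem_nhds (zero_lt_one (α := ℝ)))) |>.exists
  have hθ0 : 0 < θ := hθ0
  have hθ1 : θ < 1 := hθ1
  refine ⟨(1 - θ) • a + θ • g, hG h.1 hg (by linarith) hθ0.le (by ring), ?_, ?_⟩
  · rw [inner_add_right, inner_smul_right, inner_smul_right, hκa]
    exact hθ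
  · rw [← sub_neg, ← inner_sub_left, inner_add_right, inner_smul_right, inner_smul_right, hself,
      mul_zero, zero_add]
    exact mul_neg_of_pos_of_neg hθ0 hlt

end ConeProjection

/-! ### Contiguity and asymptotic normality under local alternatives. -/

section ThirdLemma

variable {Ω : Type*} [MeasurableSpace Ω] {𝓜 : Set (ProbabilityMeasure Ω)}
  {P : ProbabilityMeasure Ω} {g : Lp ℝ 2 (P : Measure Ω)} {Q : ℝ → ProbabilityMeasure Ω}

theorem tendsto_div_sqrt_nhdsGT_zero {t : ℝ} (ht : 0 < t) :
    Tendsto (fun n : ℕ => t / √(n : ℝ)) atTop (𝓝[>] 0) := by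
  have h1 : Tendsto (fun n : ℕ => (√(n : ℝ))⁻¹) atTop (𝓝[>] 0) :=
    tendsto_inv_atTop_nhdsGT_zero.comp (Real.tendsto_sqrt_atTop.comp tendsto_natCast_atTop_atTop)
  exact (tendsto_const_mul_nhdsGT_zero ht).comp h1

theorem natCast_mul_div_sqrt_sq {n : ℕ} (hn : 0 < n) (t : ℝ) :
    (n : ℝ) * (t / √(n : ℝ)) ^ 2 = t ^ 2 := by
  have hn' : (0 : ℝ) < n := by exact_mod_cast hn
  rw [div_pow, Real.sq_sqrt hn'.le]
  field_simp

/-- The perturbation of `P` with the truncated and centered score. -/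
noncomputable def clampedLaw (P : Measure Ω) (g : Ω → ℝ) (s : ℝ) : Measure Ω :=
  P.withDensity fun x => ENNReal.ofReal (1 + s * clampedScore P g s x)

/-- The products of a local alternative and of the truncated perturbation with the same tangent
are asymptotically indistinguishable. -/
theorem IsLocalAlternative.tendsto_iidLaw_sub_clampedLaw (hQ : IsLocalAlternative 𝓜 P g Q)
    (hg0 : ∫ x, g x ∂(P : Measure Ω) = 0) {t : ℝ} (ht : 0 < t) {A : (n : ℕ) → Set (Fin n → Ω)}
    (hA : ∀ n, MeasurableSet (A n)) :
    Tendsto (fun n : ℕ => (iidLaw (Q (t / √(n : ℝ))) n).real (A n) -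
      (Measure.pi fun _ : Fin n => clampedLaw (P : Measure Ω) g (t / √(n : ℝ))).real (A n))
      atTop (𝓝 0) := by
  have hgm := (Lp.stronglyMeasurable g).measurable
  have hgL := Lp.memLp g
  -- s² D(s) bounds the squared Hellinger distance; since n(t/√n)² = t², the products differ by at
  -- most 2√(t² D(t/√n)).
  set D : ℝ → ℝ := fun s => 2 * ((∫ x, rootRemainder P (Q s) g s x ^ 2
      ∂((P : Measure Ω) + (Q s : Measure Ω))) / s ^ 2) +
    2 * (s / 8 * ∫ x, g x ^ 2 ∂(P : Measure Ω) +
      1 / 2 * ∫ x, (clampedScore P g s x - g x) ^ 2 ∂(P : Measure Ω)) with hD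
  have hD0 : Tendsto D (𝓝[>] 0) (𝓝 0) := by
    have h1 : Tendsto (fun s : ℝ => s) (𝓝[>] 0) (𝓝 0) := nhdsWithin_le_nhds
    have h2 := (hQ.tendsto_integral_sq.const_mul 2).add
      ((((h1.div_const 8).mul_const (∫ x, g x ^ 2 ∂(P : Measure Ω))).add
        ((tendsto_integral_clampedScore_sub_sq hgm hgL hg0).const_mul (1 / 2))).const_mul 2)
    simpa [hD] using h2
  have hlim : Tendsto (fun n : ℕ => 2 * √(t ^ 2 * D (t / √(n : ℝ)))) atTop (𝓝 0) := by
    simpa using ((hD0.comp (tendsto_div_sqrt_nhdsGT_zero ht)).const_mul (t ^ 2)).sqrt.const_mul 2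
  refine squeeze_zero_norm' ?_ hlim
  filter_upwards [eventually_gt_atTop 0] with n hn
  have hs : 0 < t / √(n : ℝ) := div_pos ht (Real.sqrt_pos.2 (by exact_mod_cast hn))
  have hn2 := natCast_mul_div_sqrt_sq hn t
  set s := t / √(n : ℝ)
  have hhm := measurable_clampedScore (P := (P : Measure Ω)) hgm s
  have hhi := ((memLp_clampedScore hgm hgL s).integrable (by norm_num)).const_mul s
  have hw0 : ∀ x, 0 ≤ 1 + s * clampedScore P g s x := fun x => by
    linarith [half_le_one_add_mul_clampedScore (P := (P : Measure Ω)) g hs.le x]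
  refine (abs_iidLaw_real_sub_le P (Q s) g s (by fun_prop) hw0 ((integrable_const 1).add hhi)
    (by rw [integral_add (integrable_const 1) hhi, integral_const_mul,
          integral_clampedScore hgm hgL]; simp) n (hA n)).trans ?_
  have hb := integral_sqrt_one_add_clampedScore_le hgm hgL hs.le
  gcongr 2 * √?_
  rw [← hn2, mul_assoc]
  gcongr (n : ℝ) * ?_
  rw [hD]
  have e : s ^ 2 * (2 * ((∫ x, rootRemainder P (Q s) g s x ^ 2
      ∂((P : Measure Ω) + (Q s : Measure Ω))) / s ^ 2)) = 2 * ∫ x, rootRemainder P (Q s) g s x ^ 2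
      ∂((P : Measure Ω) + (Q s : Measure Ω)) := by
    field_simp
  simp only
  rw [mul_add, e]
  linarith

/-- Contiguity of a local alternative to the fixed law. -/
theorem IsLocalAlternative.tendsto_iidLaw_of_tendsto (hQ : IsLocalAlternative 𝓜 P g Q)
    (hg0 : ∫ x, g x ∂(P : Measure Ω) = 0) {t : ℝ} (ht : 0 < t) {A : (n : ℕ) → Set (Fin n → Ω)}
    (hA : ∀ n, MeasurableSet (A n))
    (hPA : Tendsto (fun n : ℕ => (iidLaw P n).real (A n)) atTop (𝓝 0)) :
    Tendsto (fun n : ℕ => (iidLaw (Q (t / √(n : ℝ))) n).real (A n)) atTop (𝓝 0) := by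
  have hgm := (Lp.stronglyMeasurable g).measurable
  have hgL := Lp.memLp g
  set C := ∫ x, g x ^ 2 ∂(P : Measure Ω)
  have h1 : Tendsto (fun n : ℕ => √(Real.exp (t ^ 2 * C)) * √((iidLaw P n).real (A n))) atTop
      (𝓝 0) := by
    simpa using hPA.sqrt.const_mul (√(Real.exp (t ^ 2 * C)))
  have h2 : Tendsto (fun n : ℕ => (Measure.pi fun _ : Fin n =>
      clampedLaw (P : Measure Ω) g (t / √(n : ℝ))).real (A n)) atTop (𝓝 0) := by
    refine squeeze_zero' (Eventually.of_forall fun n => measureReal_nonneg) ?_ h1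
    filter_upwards [eventually_gt_atTop 0] with n hn
    have hs : 0 < t / √(n : ℝ) := div_pos ht (Real.sqrt_pos.2 (by exact_mod_cast hn))
    have hn2 := natCast_mul_div_sqrt_sq hn t
    set s := t / √(n : ℝ)
    have hh := memLp_clampedScore hgm hgL s
    have hhm := measurable_clampedScore (P := (P : Measure Ω)) hgm s
    have h3 : MemLp (fun _ : Ω => (1 : ℝ)) 2 (P : Measure Ω) := memLp_const 1
    have hw : MemLp (fun x => 1 + s * clampedScore P g s x) 2 (P : Measure Ω) :=
      h3.add (hh.const_mul s)
    refine (pi_withDensity_real_le (μ := (P : Measure Ω)) (by fun_prop)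
      (fun x => by linarith [half_le_one_add_mul_clampedScore (P := (P : Measure Ω)) g hs.le x])
      hw n (hA n)).trans ?_
    refine mul_le_mul_of_nonneg_right (Real.sqrt_le_sqrt ?_) (Real.sqrt_nonneg _)
    have e := integral_add_const_mul_sq (memLp_const (μ := (P : Measure Ω)) (1 : ℝ)) hh s
    simp only [one_pow, one_mul, integral_const, probReal_univ, smul_eq_mul,
      integral_clampedScore hgm hgL, mul_zero, add_zero] at e
    rw [e]
    -- The n-th power of this bound is exp(t² C), independent of n.
    have hle : 1 + s ^ 2 * ∫ x, clampedScore P g s x ^ 2 ∂(P : Measure Ω) ≤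
        Real.exp (s ^ 2 * C) := by
      have h3 := mul_le_mul_of_nonneg_left (integral_clampedScore_sq_le hgm hgL s) (sq_nonneg s)
      linarith [Real.add_one_le_exp (s ^ 2 * C)]
    refine (pow_le_pow_left₀ (add_nonneg zero_le_one (mul_nonneg (sq_nonneg s)
      (integral_nonneg fun x => sq_nonneg _))) hle n).trans (le_of_eq ?_)
    rw [← Real.exp_nat_mul, ← mul_assoc, hn2]
  simpa using (hQ.tendsto_iidLaw_sub_clampedLaw hg0 ht hA).add h2

/-- Asymptotic normality of normalized sums along a local alternative. -/
theorem IsLocalAlternative.tendsto_iidLaw_real_le (hQ : IsLocalAlternative 𝓜 P g Q)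
    (hg0 : ∫ x, g x ∂(P : Measure Ω) = 0) {a : Lp ℝ 2 (P : Measure Ω)} (ha : a ≠ 0)
    (ha0 : ∫ x, a x ∂(P : Measure Ω) = 0) {t : ℝ} (ht : 0 < t) (y : ℝ) :
    Tendsto (fun n : ℕ => (iidLaw (Q (t / √(n : ℝ))) n).real
        {x | (√(n : ℝ))⁻¹ * ∑ i, a (x i) ≤ y}) atTop
      (𝓝 (cdf (gaussianReal (t * inner ℝ a g) (‖a‖ ^ 2).toNNReal) y)) := by
  have hgm := (Lp.stronglyMeasurable g).measurable
  have hgL := Lp.memLp g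
  have ham := (Lp.stronglyMeasurable a).measurable
  have e1 : inner ℝ a g = ∫ x, a x * g x ∂(P : Measure Ω) := by
    rw [L2.inner_def]
    congr 1; ext x; simp [mul_comm]
  have e2 : ‖a‖ ^ 2 = ∫ x, a x ^ 2 ∂(P : Measure Ω) := by
    rw [← real_inner_self_eq_norm_sq, L2.inner_def]
    congr 1; ext x; simp
  have hpos : 0 < ∫ x, a x ^ 2 ∂(P : Measure Ω) := by rw [← e2]; positivity
  rw [e1, e2]
  have hs : ∀ n : ℕ, 0 ≤ t / √(n : ℝ) := fun n => by positivity
  have h := tendsto_pi_withDensity_real_le ham (Lp.memLp a) ha0 hpos hgL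
    (h := fun n => clampedScore P g (t / √(n : ℝ)))
    (fun n => measurable_clampedScore hgm _) (fun n => memLp_clampedScore hgm hgL _)
    (fun n => integral_clampedScore hgm hgL _) t
    (fun n x => by linarith [half_le_one_add_mul_clampedScore (P := (P : Measure Ω)) g (hs n) x])
    ((tendsto_integral_clampedScore_sub_sq hgm hgL hg0).comp (tendsto_div_sqrt_nhdsGT_zero ht)) y
  have hA : ∀ n : ℕ, MeasurableSet {x : Fin n → Ω | (√(n : ℝ))⁻¹ * ∑ i, a (x i) ≤ y} := fun n =>
    measurableSet_le (by fun_prop) measurable_const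
  have h2 := (hQ.tendsto_iidLaw_sub_clampedLaw hg0 ht hA).add h
  rw [zero_add] at h2
  exact h2.congr fun n => sub_add_cancel _ _

end ThirdLemma

/-! ### Normal distribution functions. -/

section GaussianCDF

theorem continuous_cdf_of_nullSingleton (μ : Measure ℝ) [IsProbabilityMeasure μ]
    (h : ∀ x, μ {x} = 0) : Continuous (cdf μ) := by
  refine continuous_iff_continuousAt.2 fun x => ?_
  have h1 := (cdf μ).measure_singleton x
  rw [measure_cdf, h x] at h1
  have h2 := ENNReal.ofReal_eq_zero.1 h1.symm
  have hl : Function.leftLim (cdf μ) x = cdf μ x :=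
    le_antisymm ((monotone_cdf μ).leftLim_le le_rfl) (by linarith)
  rw [(monotone_cdf μ).continuousAt_iff_leftLim_eq_rightLim, hl, (cdf μ).rightLim_eq]

theorem continuous_cdf_gaussianReal (m : ℝ) {v : NNReal} (hv : v ≠ 0) :
    Continuous (cdf (gaussianReal m v)) := by
  have := nullSingletonClass_gaussianReal (μ := m) hv
  exact continuous_cdf_of_nullSingleton _ fun x => measure_singleton x

theorem cdf_gaussianReal_eq (m : ℝ) (v : NNReal) (y : ℝ) :
    cdf (gaussianReal m v) y = cdf (gaussianReal 0 v) (y - m) := by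
  have h := gaussianReal_map_add_const (μ := 0) (v := v) m
  rw [zero_add] at h
  rw [cdf_eq_real, cdf_eq_real, ← h, map_measureReal_apply (by fun_prop) measurableSet_Iic]
  congr 1
  ext x
  simp [le_sub_iff_add_le]

/-- Lebesgue measure is absolutely continuous with respect to the normal law, so a half-line cannot
be a null set. -/
theorem stdNormalCDF_pos (x : ℝ) : 0 < stdNormalCDF x := by
  unfold stdNormalCDF
  rw [cdf_eq_real, measureReal_def, ENNReal.toReal_pos_iff]
  refine ⟨pos_iff_ne_zero.2 fun h => ?_, measure_lt_top _ _⟩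
  simpa using gaussianReal_absolutelyContinuous' 0 one_ne_zero h

end GaussianCDF

/-! ### A Slutsky argument for positive parts. -/

section OneSidedSlutsky

/-- If the positive parts of `Wₙ` approximate `Vₙ` in probability, then the distribution functions
of `Vₙ` and of `Wₙ` have the same limit at positive arguments. -/
theorem tendsto_real_le_of_posPart {X : ℕ → Type*} [∀ n, MeasurableSpace (X n)]
    (ν : (n : ℕ) → Measure (X n)) [∀ n, IsProbabilityMeasure (ν n)] (V W : (n : ℕ) → X n → ℝ)
    {F : ℝ → ℝ} {a : ℝ} {b : ℕ → ℝ} (ha : 0 < a) (hb : Tendsto b atTop (𝓝 a))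
    (hF : ContinuousAt F a)
    (hW : ∀ y, Tendsto (fun n => (ν n).real {x | W n x ≤ y}) atTop (𝓝 (F y)))
    (hV : ∀ ε : ℝ, 0 < ε →
      Tendsto (fun n => (ν n).real {x | ε ≤ |V n x - max (W n x) 0|}) atTop (𝓝 0)) :
    Tendsto (fun n => (ν n).real {x | V n x ≤ b n}) atTop (𝓝 (F a)) := by
  have hδ : ∀ c : ℝ, Tendsto (fun δ : ℝ => a + c * δ) (𝓝[>] 0) (𝓝 a) := fun c => by
    have : ContinuousAt (fun δ : ℝ => a + c * δ) 0 := by fun_prop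
    simpa using this.tendsto.mono_left (nhdsWithin_le_nhds (s := Set.Ioi 0))
  refine tendsto_order.2 ⟨fun l hl => ?_, fun u hu => ?_⟩
  -- One δ absorbs the error in V, the other that in b. Positivity of a enters here: W ≤ a - 2δ
  -- bounds its positive part only if a - 2δ ≥ 0. The upper bound below needs no such condition, as
  -- W never exceeds its positive part.
  · obtain ⟨δ, ⟨h1, h2⟩, h3⟩ := ((((hF.tendsto.comp (hδ (-2))).eventually (lt_mem_nhds hl)).and
      ((hδ (-2)).eventually (lt_mem_nhds ha))).and
      (self_mem_nhdsWithin : Set.Ioi (0 : ℝ) ∈ 𝓝[>] 0)).exists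
    have h3 : 0 < δ := h3
    have hlim := (hW (a + -2 * δ)).sub (hV δ h3)
    rw [sub_zero] at hlim
    filter_upwards [hlim.eventually (lt_mem_nhds h1),
      hb.eventually (lt_mem_nhds (show a - δ < a by linarith))] with n hn hbn
    refine hn.trans_le (sub_le_iff_le_add.2 ((measureReal_mono ?_).trans
      (measureReal_union_le _ _)))
    intro x hx
    by_cases hx2 : δ ≤ |V n x - max (W n x) 0|
    · exact Or.inr hx2
    · refine Or.inl ?_
      have hx : W n x ≤ a + -2 * δ := hx
      have hm : max (W n x) 0 ≤ a + -2 * δ := max_le hx h2.le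
      have := (abs_lt.1 (not_le.1 hx2)).2
      change V n x ≤ b n
      linarith
  · obtain ⟨δ, h1, h3⟩ := (((hF.tendsto.comp (hδ 2)).eventually (gt_mem_nhds hu)).and
      (self_mem_nhdsWithin : Set.Ioi (0 : ℝ) ∈ 𝓝[>] 0)).exists
    have h3 : 0 < δ := h3
    have hlim := (hW (a + 2 * δ)).add (hV δ h3)
    rw [add_zero] at hlim
    filter_upwards [hlim.eventually (gt_mem_nhds h1),
      hb.eventually (gt_mem_nhds (show a < a + δ by linarith))] with n hn hbn
    refine ((measureReal_mono ?_).trans (measureReal_union_le _ _)).trans_lt hn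
    intro x hx
    by_cases hx2 : δ ≤ |V n x - max (W n x) 0|
    · exact Or.inr hx2
    · refine Or.inl ?_
      have hx : V n x ≤ b n := hx
      have := (abs_lt.1 (not_le.1 hx2)).1
      have := le_max_left (W n x) 0
      change W n x ≤ a + 2 * δ
      linarith

end OneSidedSlutsky

/-! ### Coverage probabilities of one-sided optimal estimators. -/

section Estimators

variable {Ω : Type*} [MeasurableSpace Ω] {𝓜 : Set (ProbabilityMeasure Ω)}
  {P : ProbabilityMeasure Ω} {g κ a : Lp ℝ 2 (P : Measure Ω)} {Q : ℝ → ProbabilityMeasure Ω}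
  {T : ProbabilityMeasure Ω → ℝ}

instance isProbabilityMeasure_iidLaw (Q : ProbabilityMeasure Ω) (n : ℕ) :
    IsProbabilityMeasure (iidLaw Q n) := by
  unfold iidLaw; infer_instance

theorem DifferentiableAlong.tendsto_sqrt_mul_sub (hT : DifferentiableAlong T P κ g Q) {t : ℝ}
    (ht : 0 < t) :
    Tendsto (fun n : ℕ => √(n : ℝ) * (T (Q (t / √(n : ℝ))) - T P)) atTop
      (𝓝 (t * inner ℝ κ g)) := by
  have h1 := (IsLittleO.tendsto_div_nhds_zero hT).comp (tendsto_div_sqrt_nhdsGT_zero ht)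
  have h2 := (h1.const_mul t).add_const (t * inner ℝ κ g)
  rw [mul_zero, zero_add] at h2
  refine h2.congr' ?_
  filter_upwards [eventually_gt_atTop 0] with n hn
  have hn' : 0 < √(n : ℝ) := Real.sqrt_pos.2 (by exact_mod_cast hn)
  simp only [Function.comp_apply]
  field_simp
  ring

/-- Limit of the probability that an upper confidence bound built on an estimator of the one-sided
optimal form covers the functional, along a local alternative with an increasing functional. -/
theorem HasOneSidedOptimalForm.tendsto_coverage {S : (n : ℕ) → (Fin n → Ω) → ℝ}
    (hS : HasOneSidedOptimalForm T P a S) (hSm : ∀ n, Measurable (S n)) (ha : a ≠ 0)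
    (ha0 : ∫ x, a x ∂(P : Measure Ω) = 0) (hg0 : ∫ x, g x ∂(P : Measure Ω) = 0)
    (hQ : IsLocalAlternative 𝓜 P g Q) (hT : DifferentiableAlong T P κ g Q)
    (hκg : 0 < inner ℝ κ g) {c : ℝ} (hc : 0 ≤ c) {t : ℝ} (ht : 0 < t) :
    Tendsto (fun n : ℕ => (iidLaw (Q (t / √(n : ℝ))) n).real
        {x | T (Q (t / √(n : ℝ))) ≥ S n x - c / √(n : ℝ)}) atTop
      (𝓝 (cdf (gaussianReal 0 (‖a‖ ^ 2).toNNReal) (c + t * (inner ℝ κ g - inner ℝ a g)))) := by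
  have hv : (‖a‖ ^ 2).toNNReal ≠ 0 := (Real.toNNReal_pos.2 (by positivity)).ne'
  have ham := (Lp.stronglyMeasurable a).measurable
  have hb := (hT.tendsto_sqrt_mul_sub ht).const_add c
  have hpos : 0 < c + t * inner ℝ κ g := by positivity
  have h := tendsto_real_le_of_posPart (fun n => iidLaw (Q (t / √(n : ℝ))) n)
    (fun n x => √(n : ℝ) * max (S n x - T P) 0) (fun n x => (√(n : ℝ))⁻¹ * ∑ i, a (x i))
    hpos hb (continuous_cdf_gaussianReal (t * inner ℝ a g) hv).continuousAt
    (fun y => hQ.tendsto_iidLaw_real_le hg0 ha ha0 ht y) (fun ε hε =>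
      hQ.tendsto_iidLaw_of_tendsto hg0 ht (fun n => measurableSet_le measurable_const
        (by have := hSm n; fun_prop)) (hS ε hε))
  rw [cdf_gaussianReal_eq, show c + t * inner ℝ κ g - t * inner ℝ a g =
    c + t * (inner ℝ κ g - inner ℝ a g) by ring] at h
  refine h.congr' ?_
  filter_upwards [eventually_gt_atTop 0, hb.eventually (lt_mem_nhds hpos)] with n hn hbn
  have hn' : 0 < √(n : ℝ) := Real.sqrt_pos.2 (by exact_mod_cast hn)
  congr 1
  ext x
  simp only [Set.mem_ofPred_eq, ge_iff_le]
  -- The threshold is eventually positive, so taking the positive part does not change the event.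
  rw [mul_max_of_nonneg _ _ hn'.le, mul_zero, max_le_iff, and_iff_left hbn.le]
  have e : √(n : ℝ) * (c / √(n : ℝ)) = c := by field_simp
  rw [← mul_le_mul_iff_of_pos_left hn' (b := S n x - c / √(n : ℝ)), mul_sub, mul_sub, mul_sub, e]
  constructor <;> intro <;> linarith

end Estimators

end OneSided

/-! ### Conclusion along the distinguishing tangent. -/

theorem mainTheorem11 {Ω : Type*} [MeasurableSpace Ω]
    -- the family of probability measures, and the fixed member `P`
    (𝓜 : Set (ProbabilityMeasure Ω)) (P : ProbabilityMeasure Ω) (hP : P ∈ 𝓜)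
    -- the tangent set (always a cone with vertex at `0`) is closed and convex
    (hclosed : IsClosed (OneSided.tangentSet 𝓜 P))
    (hconvex : Convex ℝ (OneSided.tangentSet 𝓜 P))
    -- the class of local alternatives under consideration: at least one for each tangent
    (𝓐 : Set (ℝ → ProbabilityMeasure Ω))
    (h𝓐 : ∀ g ∈ OneSided.tangentSet 𝓜 P, ∃ Q ∈ 𝓐, OneSided.IsLocalAlternative 𝓜 P g Q)
    -- the functional `T` (only its values on `𝓜` matter), differentiable with gradient `κ`
    (T : ProbabilityMeasure Ω → ℝ) (κ : Lp ℝ 2 (P : Measure Ω))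
    (hT : ∀ g ∈ OneSided.tangentSet 𝓜 P, ∀ Q ∈ 𝓐, OneSided.IsLocalAlternative 𝓜 P g Q →
      OneSided.DifferentiableAlong T P κ g Q)
    -- the projection `κ̂` of `κ` on the cone is nonzero and differs from the projection `κ̄`
    -- of `κ` on its closed linear span
    (κhat : Lp ℝ 2 (P : Measure Ω))
    (hκhat : OneSided.IsProjectionOn (OneSided.tangentSet 𝓜 P) κ κhat)
    (hκhat0 : κhat ≠ 0)
    (hne : OneSided.spanProjection (OneSided.tangentSet 𝓜 P) κ ≠ κhat) :
    ∃ g₁ ∈ OneSided.tangentSet 𝓜 P,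
      ∀ Q ∈ 𝓐, OneSided.IsLocalAlternative 𝓜 P g₁ Q →
      ∀ S : (n : ℕ) → (Fin n → Ω) → ℝ, (∀ n, Measurable (S n)) →
        OneSided.HasOneSidedOptimalForm T P κhat S →
        (∀ c : ℝ, 0 ≤ c →
          OneSided.HasIteratedLimit
            (fun t n => (OneSided.iidLaw (Q (t / √(n : ℝ))) n).real
              {x | T (Q (t / √(n : ℝ))) ≥ S n x - c / √(n : ℝ)}) 0 ∧
          0 < OneSided.stdNormalCDF (c / ‖κhat‖)) ∧
        OneSided.HasIteratedLimit
          (fun t n => (OneSided.iidLaw (Q (t / √(n : ℝ))) n).real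
            {x | S n x > T (Q (t / √(n : ℝ)))}) 1 ∧
        ¬ OneSided.HasAsymptoticMedianLE T Q S := by
  obtain ⟨g, hg, hκg, hlt⟩ := hκhat.exists_inner_lt hconvex
    (fun g hg r hr => OneSided.smul_mem_tangentSet hg hr) hκhat0 hne
  refine ⟨g, hg, fun Q hQA hQ S hSm hS => ?_⟩
  set L : ℝ → ℝ → ℝ := fun c t =>
    cdf (gaussianReal 0 (‖κhat‖ ^ 2).toNNReal) (c + t * (inner ℝ κ g - inner ℝ κhat g)) with hL
  have hlim : ∀ c : ℝ, 0 ≤ c → ∀ t : ℝ, 0 < t → Tendsto (fun n : ℕ =>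
      (OneSided.iidLaw (Q (t / √(n : ℝ))) n).real
        {x | T (Q (t / √(n : ℝ))) ≥ S n x - c / √(n : ℝ)}) atTop (𝓝 (L c t)) :=
    fun c hc t ht => hS.tendsto_coverage hSm hκhat0 hκhat.1.1 hg.1 hQ (hT g hg Q hQA hQ) hκg hc ht
  -- The argument of the distribution function drifts to -∞ because ⟨κ, g⟩ < ⟨κhat, g⟩.
  have hL0 : ∀ c : ℝ, Tendsto (L c) atTop (𝓝 0) := fun c =>
    (tendsto_cdf_atBot _).comp (tendsto_atBot_add_const_left _ c
      (tendsto_id.atTop_mul_const_of_neg (sub_neg.2 hlt)))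
  have hlim1 : ∀ t : ℝ, 0 < t → Tendsto (fun n : ℕ =>
      (OneSided.iidLaw (Q (t / √(n : ℝ))) n).real {x | S n x > T (Q (t / √(n : ℝ)))}) atTop
      (𝓝 (1 - L 0 t)) := by
    intro t ht
    refine ((hlim 0 le_rfl t ht).const_sub 1).congr fun n => ?_
    -- Overestimation is the complement of coverage with c = 0.
    rw [← probReal_compl_eq_one_sub (measurableSet_le ((hSm n).sub_const _) measurable_const)]
    congr 1
    ext x
    simp
  have hL1 : Tendsto (fun t => 1 - L 0 t) atTop (𝓝 1) := by
    simpa using (hL0 0).const_sub 1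
  refine ⟨fun c hc => ⟨⟨L c, hlim c hc, hL0 c⟩, OneSided.stdNormalCDF_pos _⟩,
    ⟨_, hlim1, hL1⟩, fun hmed => ?_⟩
  obtain ⟨t, ht, ht0⟩ := ((hL1.eventually (lt_mem_nhds (by norm_num : (1 / 2 : ℝ) < 1))).and
    (eventually_gt_atTop 0)).exists
  have h := hmed t ht0
  rw [(hlim1 t ht0).limsup_eq] at h
  exact absurd ht (not_lt.2 h)
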